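/- Let $X$ be a smooth affine algebraic variety over an algebraically closed field $k$ of characteristic $0$, with coordinate ring $\mathcal O=\mathcal O_X(X)$ and ring of differential operators $\mathcal D=\mathcal D_X(X)$. Let $\mathcal A$ be a differential non-negatively graded commutative $\mathcal D$-algebra, that is, a commutative monoid in the symmetric monoidal category of non-negatively graded chain complexes of left $\mathcal D$-modules, with the tensor product taken over $\mathcal O$ (vector fields act on a tensor product by the Leibniz rule). Let $\mathrm{Mod}(\mathcal A)$ be the category of $\mathcal A$-modules in this category of complexes, equipped with the following classes of morphisms: weak equivalences are the quasi-isomorphisms, fibrations are the morphisms that are surjective in all positive degrees, and cofibrations are the morphisms that have the left lifting property with respect to all morphisms that are both fibrations and weak equivalences. An object $C$ is cofibrant if $0\to C$ is a cofibration. A Sullivan $\mathcal A$-module is an object of $\mathrm{Mod}(\mathcal A)$ of the form $(\mathcal A\otimes_{\mathcal O}V,d)$, with the natural graded $\mathcal D$-module structure and $\mathcal A$-action, where $V$ is a free non-negatively graded $\mathcal D$-module that admits a homogeneous basis $(m_\alpha)_{\alpha\in I}$ indexed by a well-ordered set $I$ such that $$d\,m_\alpha\in\mathcal A\otimes_{\mathcal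 O}V_{<\alpha},\qquad V_{<\alpha}:=\bigoplus_{\beta<\alpha}\mathcal D\cdot m_\beta ,\qquad\text{for all }\alpha\in I .$$ Theorem. An object of $\mathrm{Mod}(\mathcal A)$ is cofibrant if and only if it is a retract, in $\mathrm{Mod}(\mathcal A)$, of a Sullivan $\mathcal A$-module. -/

import Mathlib

open CategoryTheory CategoryTheory.Limits HomotopicalAlgebra TensorProduct

universe v u

/-! ### The ring of differential operators -/

section DiffOp

variable (k : Type v) (O : Type u) [Field k] [CommRing O] [Algebra k O]

/-- `HasDiffOrder k O n P`: the `k`-linear endomorphism `P` of `O` is a differential operator of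
order at most `n`, i.e. it lies in `F_n`, where `F_{-1} = 0` and
`F_n = {P | [P, f] ∈ F_{n-1} for all f ∈ O}`. -/
def HasDiffOrder : ℕ → Module.End k O → Prop
  | 0, P => ∀ f : O, P * LinearMap.mulLeft k f - LinearMap.mulLeft k f * P = 0
  | n + 1, P => ∀ f : O, HasDiffOrder n (P * LinearMap.mulLeft k f - LinearMap.mulLeft k f * P)

variable {k O}

theorem HasDiffOrder.zero (n : ℕ) : HasDiffOrder k O n 0 := by
  induction n with
  | zero => intro f; simp
  | succ n ih => intro f; simpa using ih

theorem HasDiffOrder.succ {n : ℕ} {P : Module.End k O} (h : HasDiffOrder k O n P) :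
    HasDiffOrder k O (n + 1) P := by
  induction n generalizing P with
  | zero => intro f; rw [h f]; exact HasDiffOrder.zero 0
  | succ n ih => intro f; exact ih (h f)

theorem HasDiffOrder.mono {m n : ℕ} (hmn : m ≤ n) {P : Module.End k O}
    (h : HasDiffOrder k O m P) : HasDiffOrder k O n P := by
  induction hmn with
  | refl => exact h
  | step _ ih => exact ih.succ

theorem HasDiffOrder.add {n : ℕ} {P Q : Module.End k O} (hP : HasDiffOrder k O n P)
    (hQ : HasDiffOrder k O n Q) : HasDiffOrder k O n (P + Q) := by
  induction n generalizing P Q with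
  | zero =>
    intro f
    have e : (P + Q) * LinearMap.mulLeft k f - LinearMap.mulLeft k f * (P + Q)
      = (P * LinearMap.mulLeft k f - LinearMap.mulLeft k f * P)
        + (Q * LinearMap.mulLeft k f - LinearMap.mulLeft k f * Q) := by noncomm_ring
    rw [e, hP f, hQ f, add_zero]
  | succ n ih =>
    intro f
    have e : (P + Q) * LinearMap.mulLeft k f - LinearMap.mulLeft k f * (P + Q)
      = (P * LinearMap.mulLeft k f - LinearMap.mulLeft k f * P)
        + (Q * LinearMap.mulLeft k f - LinearMap.mulLeft k f * Q) := by noncomm_ring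
    rw [e]
    exact ih (hP f) (hQ f)

theorem HasDiffOrder.mul {m n : ℕ} {P Q : Module.End k O} (hP : HasDiffOrder k O m P)
    (hQ : HasDiffOrder k O n Q) : HasDiffOrder k O (m + n) (P * Q) := by
  have key : ∀ (P Q : Module.End k O) (f : O),
      P * Q * LinearMap.mulLeft k f - LinearMap.mulLeft k f * (P * Q)
      = P * (Q * LinearMap.mulLeft k f - LinearMap.mulLeft k f * Q)
        + (P * LinearMap.mulLeft k f - LinearMap.mulLeft k f * P) * Q := by
    intros
    rw [mul_sub, sub_mul]
    simp only [mul_assoc]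
    abel
  induction hN : m + n generalizing m n P Q with
  | zero =>
    obtain ⟨rfl, rfl⟩ : m = 0 ∧ n = 0 := by omega
    intro f
    rw [key, hP f, hQ f]
    simp
  | succ N ih =>
    intro f
    rw [key]
    refine HasDiffOrder.add ?_ ?_
    · cases n with
      | zero => rw [hQ f, mul_zero]; exact HasDiffOrder.zero _
      | succ n => exact ih hP (hQ f) (by omega)
    · cases m with
      | zero => rw [hP f, zero_mul]; exact HasDiffOrder.zero _
      | succ m => exact ih (hP f) hQ (by omega)

theorem hasDiffOrder_mulLeft (f : O) : HasDiffOrder k O 0 (LinearMap.mulLeft k f) := by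
  intro g
  ext x
  simp [mul_left_comm]

theorem hasDiffOrder_derivation (θ : Derivation k O O) :
    HasDiffOrder k O 1 (θ : O →ₗ[k] O) := by
  intro f
  have e : (θ : O →ₗ[k] O) * LinearMap.mulLeft k f - LinearMap.mulLeft k f * (θ : O →ₗ[k] O)
      = LinearMap.mulLeft k (θ f) := by
    ext x
    simp [mul_comm]
  rw [e]
  exact hasDiffOrder_mulLeft (θ f)

variable (k O)

/-- The `k`-algebra of differential operators on `O`, as a subalgebra of `End_k(O)`. -/
def diffOpSubalgebra : Subalgebra k (Module.End k O) where
  carrier := {P | ∃ n, HasDiffOrder k O n P}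
  mul_mem' := by
    rintro P Q ⟨m, hP⟩ ⟨n, hQ⟩
    exact ⟨m + n, hP.mul hQ⟩
  add_mem' := by
    rintro P Q ⟨m, hP⟩ ⟨n, hQ⟩
    exact ⟨max m n, (hP.mono (le_max_left m n)).add (hQ.mono (le_max_right m n))⟩
  algebraMap_mem' := by
    intro c
    refine ⟨0, ?_⟩
    have e : algebraMap k (Module.End k O) c = LinearMap.mulLeft k (algebraMap k O c) := by
      ext x
      simp [Algebra.smul_def]
    rw [e]
    exact hasDiffOrder_mulLeft _

/-- The ring `𝒟` of differential operators on `O`. When `O` is the coordinate ring of an affine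
variety `X`, this is the ring of global sections of the sheaf of differential operators of `X`. -/
def DiffOp : Type u := ↥(diffOpSubalgebra k O)

instance DiffOp.instRing : Ring (DiffOp k O) := inferInstanceAs (Ring ↥(diffOpSubalgebra k O))

instance DiffOp.instAlgebra : Algebra k (DiffOp k O) :=
  inferInstanceAs (Algebra k ↥(diffOpSubalgebra k O))

variable {O}

/-- A function, viewed as the differential operator of multiplication by it. -/
def DiffOp.ofFun : O →+* DiffOp k O where
  toFun f := ⟨LinearMap.mulLeft k f, 0, hasDiffOrder_mulLeft f⟩
  map_one' := Subtype.ext (LinearMap.mulLeft_one k O)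
  map_mul' f g := Subtype.ext (LinearMap.mulLeft_mul k O f g)
  map_zero' := Subtype.ext (LinearMap.mulLeft_zero_eq_zero k O)
  map_add' f g := Subtype.ext (LinearMap.ext fun x => add_mul f g x)

variable {k}

/-- A vector field on `X`, viewed as a differential operator. -/
def DiffOp.ofDer (θ : Derivation k O O) : DiffOp k O :=
  ⟨(θ : O →ₗ[k] O), 1, hasDiffOrder_derivation θ⟩

variable (k O)

/-- `𝒟` as an `O`-module, by multiplication from the left. -/
instance DiffOp.instModuleFun : Module O (DiffOp k O) :=
  Module.compHom (DiffOp k O) (DiffOp.ofFun k)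

instance DiffOp.instIsScalarTowerFun : IsScalarTower O (DiffOp k O) (DiffOp k O) :=
  ⟨fun f P Q => mul_assoc (DiffOp.ofFun k f) P Q⟩

end DiffOp

/-! ### Differential graded `𝒟`-algebras and their modules

Graded objects are written internally, as the direct sum of their homogeneous components.
In `M ⊗_O N`, for left `𝒟`-modules `M` and `N`, vector fields act by the Leibniz rule, so that a
`𝒟`-linear map `M ⊗_O N → P` is an `O`-bilinear map `b` with
`θ • b m n = b (θ • m) n + b m (θ • n)` for all vector fields `θ`. -/

/-- A differential non-negatively graded commutative `𝒟`-algebra, i.e. a commutative monoid in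
the symmetric monoidal category of non-negatively graded chain complexes of left `𝒟`-modules with
tensor product over `O`. -/
structure DGDAlg (k : Type v) (O : Type u) [Field k] [CommRing O] [Algebra k O] where
  carrier : Type u
  [ring : Ring carrier]
  [algebraFun : Algebra O carrier]
  [moduleD : Module (DiffOp k O) carrier]
  /-- The `O`-module structure is the restriction of the `𝒟`-module structure. -/
  [tower : IsScalarTower O (DiffOp k O) carrier]
  /-- The homogeneous components. -/
  gr : ℕ → Submodule (DiffOp k O) carrier
  isInternal : DirectSum.IsInternal gr
  one_mem : (1 : carrier) ∈ gr 0
  mul_mem : ∀ {i j : ℕ} {a b : carrier}, a ∈ gr i → b ∈ gr j → a * b ∈ gr (i + j)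
  mul_comm_of_mem : ∀ {i j : ℕ} {a b : carrier}, a ∈ gr i → b ∈ gr j →
    a * b = (-1 : ℤ) ^ (i * j) • (b * a)
  /-- The multiplication `A ⊗_O A → A` is `𝒟`-linear. -/
  der_mul : ∀ (θ : Derivation k O O) (a b : carrier),
    DiffOp.ofDer θ • (a * b) = (DiffOp.ofDer θ • a) * b + a * (DiffOp.ofDer θ • b)
  /-- The differential, of degree `-1`. -/
  d : carrier →ₗ[DiffOp k O] carrier
  d_mem : ∀ {n : ℕ} {a : carrier}, a ∈ gr (n + 1) → d a ∈ gr n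
  d_of_mem_zero : ∀ {a : carrier}, a ∈ gr 0 → d a = 0
  d_d : ∀ a : carrier, d (d a) = 0
  d_mul : ∀ {i : ℕ} {a : carrier} (b : carrier), a ∈ gr i →
    d (a * b) = d a * b + (-1 : ℤ) ^ i • (a * d b)

attribute [instance] DGDAlg.ring DGDAlg.algebraFun DGDAlg.moduleD DGDAlg.tower

section Modules

variable {k : Type v} {O : Type u} [Field k] [CommRing O] [Algebra k O]

/-- A module over `A` in the category of non-negatively graded chain complexes of left
`𝒟`-modules. -/
structure DGDMod (A : DGDAlg k O) where
  carrier : Type u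
  [addCommGroup : AddCommGroup carrier]
  [moduleFun : Module O carrier]
  [moduleD : Module (DiffOp k O) carrier]
  /-- The `O`-module structure is the restriction of the `𝒟`-module structure. -/
  [towerD : IsScalarTower O (DiffOp k O) carrier]
  /-- The action of the ring underlying `A`. -/
  [moduleA : Module A.carrier carrier]
  /-- The `A`-action is `O`-bilinear. -/
  [towerA : IsScalarTower O A.carrier carrier]
  /-- The homogeneous components. -/
  gr : ℕ → Submodule (DiffOp k O) carrier
  isInternal : DirectSum.IsInternal gr
  smul_mem : ∀ {i j : ℕ} {a : A.carrier} {m : carrier}, a ∈ A.gr i → m ∈ gr j →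
    a • m ∈ gr (i + j)
  /-- The action `A ⊗_O M → M` is `𝒟`-linear. -/
  der_smul : ∀ (θ : Derivation k O O) (a : A.carrier) (m : carrier),
    DiffOp.ofDer θ • (a • m) = (DiffOp.ofDer θ • a) • m + a • (DiffOp.ofDer θ • m)
  /-- The differential, of degree `-1`. -/
  d : carrier →ₗ[DiffOp k O] carrier
  d_mem : ∀ {n : ℕ} {m : carrier}, m ∈ gr (n + 1) → d m ∈ gr n
  d_of_mem_zero : ∀ {m : carrier}, m ∈ gr 0 → d m = 0
  d_d : ∀ m : carrier, d (d m) = 0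
  d_smul : ∀ {i : ℕ} {a : A.carrier} (m : carrier), a ∈ A.gr i →
    d (a • m) = A.d a • m + (-1 : ℤ) ^ i • (a • d m)

attribute [instance] DGDMod.addCommGroup DGDMod.moduleFun DGDMod.moduleD DGDMod.towerD
  DGDMod.moduleA DGDMod.towerA

namespace DGDMod

variable {A : DGDAlg k O}

/-- Morphisms of `A`-modules: `A`- and `𝒟`-linear chain maps of degree `0`. -/
@[ext]
structure Hom (M N : DGDMod A) where
  toLin : M.carrier →ₗ[DiffOp k O] N.carrier
  map_smul : ∀ (a : A.carrier) (m : M.carrier), toLin (a • m) = a • toLin m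
  map_mem : ∀ {n : ℕ} {m : M.carrier}, m ∈ M.gr n → toLin m ∈ N.gr n
  map_d : ∀ m : M.carrier, toLin (M.d m) = N.d (toLin m)

instance : Category (DGDMod A) where
  Hom := Hom
  id M :=
    { toLin := LinearMap.id
      map_smul := fun _ _ => rfl
      map_mem := fun h => h
      map_d := fun _ => rfl }
  comp f g :=
    { toLin := g.toLin ∘ₗ f.toLin
      map_smul := fun a m => by simp [f.map_smul, g.map_smul]
      map_mem := fun h => g.map_mem (f.map_mem h)
      map_d := fun m => by simp [f.map_d, g.map_d] }

variable (A) in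
/-- The zero `A`-module. -/
def zero : DGDMod A where
  carrier := PUnit
  gr _ := ⊤
  isInternal := by
    rw [DirectSum.isInternal_submodule_iff_iSupIndep_and_iSup_eq_top]
    exact ⟨fun i => Submodule.disjoint_def.2 fun x _ _ => Subsingleton.elim (α := PUnit) x 0,
      eq_top_iff.2 fun x _ => by
        rw [Subsingleton.elim (α := PUnit) x 0]; exact Submodule.zero_mem _⟩
  smul_mem _ _ := trivial
  der_smul _ _ _ := rfl
  d := 0
  d_mem _ := trivial
  d_of_mem_zero _ := rfl
  d_d _ := rfl
  d_smul _ _ := rfl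

variable (A) in
/-- The zero `A`-module is an initial object. -/
def zeroIsInitial : IsInitial (zero A) :=
  IsInitial.ofUniqueHom
    (fun M =>
      { toLin := 0
        map_smul := fun a _ => (smul_zero a).symm
        map_mem := fun {n} _ _ => (M.gr n).zero_mem
        map_d := fun _ => (map_zero M.d).symm })
    (fun M f => by
      apply Hom.ext
      ext x
      have hx : x = 0 := Subsingleton.elim (α := PUnit) x 0
      rw [hx, map_zero, map_zero])

instance : HasInitial (DGDMod A) := (zeroIsInitial A).hasInitial

/-- The cycles of `M` (in all degrees). -/
def cycles (M : DGDMod A) : Submodule (DiffOp k O) M.carrier := LinearMap.ker M.d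

/-- The boundaries of `M`, as a submodule of the cycles. -/
def boundaries (M : DGDMod A) : Submodule (DiffOp k O) M.cycles :=
  (LinearMap.range M.d).comap M.cycles.subtype

/-- The homology of `M`: the direct sum of the `𝒟`-modules `H_n(M)`. -/
abbrev Homology (M : DGDMod A) : Type u := M.cycles ⧸ M.boundaries

/-- The map induced on cycles. -/
def mapCycles {M N : DGDMod A} (f : M ⟶ N) : M.cycles →ₗ[DiffOp k O] N.cycles :=
  f.toLin.restrict fun m hm => by
    have hm' : M.d m = 0 := hm
    change N.d (f.toLin m) = 0
    rw [← f.map_d, hm', map_zero]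

/-- The map induced on homology. -/
def mapHomology {M N : DGDMod A} (f : M ⟶ N) : M.Homology →ₗ[DiffOp k O] N.Homology :=
  Submodule.mapQ _ _ (mapCycles f) (by
    rintro ⟨z, hz⟩ ⟨m, hm⟩
    exact ⟨f.toLin m, by rw [← f.map_d, hm]; rfl⟩)

/-- Weak equivalences are the quasi-isomorphisms. -/
instance : CategoryWithWeakEquivalences (DGDMod A) where
  weakEquivalences := fun _ _ f => Function.Bijective (mapHomology f)

/-- Fibrations are the morphisms that are surjective in all positive degrees. -/
instance : CategoryWithFibrations (DGDMod A) where
  fibrations := fun M N f => ∀ n : ℕ, 0 < n → ∀ y ∈ N.gr n, ∃ x ∈ M.gr n, f.toLin x = y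

/-- Cofibrations are the morphisms that have the left lifting property with respect to trivial
fibrations. -/
instance : CategoryWithCofibrations (DGDMod A) where
  cofibrations := (trivialFibrations (DGDMod A)).llp

/-- For a family `m` of elements of an `A`-module `S`, with index set `ι`, and the free `𝒟`-module
`V` with basis `ι`, this is the map `A ⊗_O V → S`, `a ⊗ ∑ Δ_α e_α ↦ a • ∑ Δ_α • m_α`. -/
noncomputable def freeMap (S : DGDMod A) {ι : Type u} (m : ι → S.carrier) :
    A.carrier ⊗[O] (ι →₀ DiffOp k O) →ₗ[O] S.carrier :=
  TensorProduct.lift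
    ((Algebra.lsmul O O S.carrier).toLinearMap.compl₂
      ((Finsupp.linearCombination (DiffOp k O) m).restrictScalars O))

/-- `S` is a Sullivan `A`-module: as a graded `𝒟`-module with `A`-action it is `A ⊗_O V`, where `V`
is a free graded `𝒟`-module with a homogeneous basis `(m_α)` indexed by a well-ordered set, and
`d m_α ∈ A ⊗_O V_{<α}` for all `α`, where `V_{<α}` is the free submodule on the `m_β` with `β < α`.
(The map `freeMap S m` respects the gradings, the `A`-actions, and the actions of functions and
vector fields. So, if it is bijective, it identifies `S` with `A ⊗_O V` as a graded `𝒟`-module with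
`A`-action.) -/
def IsSullivan (S : DGDMod A) : Prop :=
  ∃ (ι : Type u) (_ : LinearOrder ι) (_ : WellFoundedLT ι) (deg : ι → ℕ) (m : ι → S.carrier),
    (∀ α, m α ∈ S.gr (deg α)) ∧
    Function.Bijective (S.freeMap m) ∧
    ∀ α, S.d (m α) ∈ LinearMap.range (S.freeMap fun β : {β : ι // β < α} => m β)

end DGDMod

end Modules

/-! A Sullivan module lifts against every trivial fibration `p`: the images of the generators are
chosen by well-founded recursion. The boundary of a generator is already mapped to a cycle over the
right target, and `exists_lift_of_trivialFibration` finds a preimage with that prescribed boundary.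
Lifting against trivial fibrations passes to retracts, so retracts of Sullivan modules are
cofibrant.

Conversely, `trivialFibrations_augmentation` and `isSullivan_sullivanResolution` give a trivial
fibration from a Sullivan module onto any `C`. If `C` is cofibrant, the identity of `C` lifts along
it, and `C` is a retract. The resolution has one generator for every finite formal attaching datum,
so no iterated attachment or limit is needed: the cells form an inductive type, and the relation of
being a face is well-founded.

The groundwork is the `𝒟`-module structure on `A ⊗_O V`, for which only the action of functions and
vector fields is given. On a smooth algebra in characteristic zero, Euler's formula for symbols
writes every operator `P` of bounded order as a finite sum `∑ P(y_i) Q_i`, with fixed functions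
`y_i` and fixed `Q_i` generated by functions and vector fields (`exists_evalSpan_eq`). Hence
functions and vector fields generate `𝒟`, and `A ⊗_O V` embeds in a space of `A`-valued functions,
where `𝒟` acts pointwise (`evalFree_injective`). The image is stable, so the action restricts. -/

/-! ### Generation of `𝒟` by functions and vector fields -/

section Generation

variable (k : Type v) (O : Type u) [Field k] [CommRing O] [Algebra k O]

/-- On a smooth algebra there are finitely many functions `x_j` and vector fields `θ_j` such that
`df = ∑ θ_j(f) dx_j` for all functions `f`. -/
theorem exists_dual_vectorFields [Algebra.Smooth k O] :
    ∃ (J : Type u) (_ : Fintype J) (x : J → O) (θ : J → Derivation k O O),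
      ∀ f : O, KaehlerDifferential.D k O f = ∑ j, θ j f • KaehlerDifferential.D k O (x j) := by
  have hfin : (⊤ : Submodule O (Ω[O⁄k])).FG := Module.Finite.fg_top
  rw [← KaehlerDifferential.span_range_derivation,
    Submodule.fg_span_iff_fg_span_finset_subset] at hfin
  obtain ⟨s, hs, hspan⟩ := hfin
  rw [KaehlerDifferential.span_range_derivation] at hspan
  choose x hx using fun w : s => hs w.2
  have hsurj : LinearMap.range (Fintype.linearCombination O (fun w : s => (w : Ω[O⁄k]))) = ⊤ := by
    rw [Fintype.range_linearCombination, Subtype.range_coe_subtype]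
    simpa using hspan.symm
  have : Module.Projective O (Ω[O⁄k]) := Algebra.FormallySmooth.projective_kaehlerDifferential
  -- `Ω` is projective, so the surjection from the free module on the generators `dx_w` splits. The
  -- coordinates of the splitting, composed with `d`, are the vector fields.
  obtain ⟨σ, hσ⟩ := Module.projective_lifting_property _ LinearMap.id
    (LinearMap.range_eq_top.1 hsurj)
  refine ⟨s, inferInstance, x,
    fun w => ((LinearMap.proj w).comp σ).compDer (KaehlerDifferential.D k O), fun f => ?_⟩
  have := LinearMap.congr_fun hσ (KaehlerDifferential.D k O f)
  simp [Fintype.linearCombination_apply] at this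
  rw [← this]
  simp [hx, this]

variable {k O}

/-- The commutator of an operator with multiplication by `f`. -/
def opBracket (f : O) : Module.End k O →ₗ[O] Module.End k O where
  toFun P := P * LinearMap.mulLeft k f - f • P
  map_add' P Q := by rw [add_mul, smul_add]; abel
  map_smul' g P := by
    ext y
    simp [mul_sub, mul_left_comm]

theorem opBracket_apply (f : O) (P : Module.End k O) (y : O) :
    opBracket f P y = P (f * y) - f * P y := rfl

variable (k O) in
/-- The operators of order less than `n`. -/
def opLT : ℕ → Submodule O (Module.End k O)
  | 0 => ⊥
  | n + 1 => ⨅ f : O, (opLT n).comap (opBracket f)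

theorem mem_opLT_succ {n : ℕ} {P : Module.End k O} :
    P ∈ opLT k O (n + 1) ↔ ∀ f, opBracket f P ∈ opLT k O n := by
  simp [opLT, Submodule.mem_iInf]

theorem hasDiffOrder_iff_mem_opLT {n : ℕ} {P : Module.End k O} :
    HasDiffOrder k O n P ↔ P ∈ opLT k O (n + 1) := by
  induction n generalizing P with
  | zero =>
    rw [mem_opLT_succ]
    exact Iff.rfl
  | succ n ih =>
    rw [mem_opLT_succ]
    exact forall_congr' fun f => ih

theorem opLT_le_succ (n : ℕ) : opLT k O n ≤ opLT k O (n + 1) := by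
  induction n with
  | zero => exact bot_le
  | succ n ih =>
    intro P hP
    rw [mem_opLT_succ] at hP ⊢
    exact fun f => ih (hP f)

theorem opLT_mono : Monotone (opLT k O) := monotone_nat_of_le_succ opLT_le_succ

theorem opBracket_comm (f g : O) (P : Module.End k O) :
    opBracket f (opBracket g P) = opBracket g (opBracket f P) := by
  ext y
  simp only [opBracket_apply, mul_sub]
  rw [mul_left_comm g f y, mul_left_comm g f (P y)]
  abel

/-! ### Symbols of differential operators -/

section DualBasis

variable {J : Type u} [Fintype J] {x : J → O} {θ : J → Derivation k O O}

theorem derivation_eq_sum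
    (hθ : ∀ f : O, KaehlerDifferential.D k O f = ∑ j, θ j f • KaehlerDifferential.D k O (x j))
    {M : Type*} [AddCommGroup M] [Module O M] [Module k M]
    [IsScalarTower k O M] (δ : Derivation k O M) (f : O) : δ f = ∑ j, θ j f • δ (x j) := by
  rw [← δ.liftKaehlerDifferential_comp_D f, hθ f]
  simp

/-- A double bracket lowers the order by two, so modulo `opLT k O n` the map `f ↦ [P, f]` is a
derivation, and the expansion of `df` applies to it. -/
theorem opBracket_sub_sum_mem
    (hθ : ∀ f : O, KaehlerDifferential.D k O f = ∑ j, θ j f • KaehlerDifferential.D k O (x j))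
    {n : ℕ} {P : Module.End k O} (hP : P ∈ opLT k O (n + 2)) (f : O) :
    opBracket f P - ∑ j, θ j f • opBracket (x j) P ∈ opLT k O n := by
  have hP' : ∀ f g, opBracket g (opBracket f P) ∈ opLT k O n := fun f =>
    mem_opLT_succ.1 (mem_opLT_succ.1 hP f)
  let L : O →ₗ[k] Module.End k O ⧸ opLT k O n :=
    { toFun := fun f => (opLT k O n).mkQ (opBracket f P)
      map_add' := fun f g => by
        rw [← map_add]; congr 1; ext y
        simp only [opBracket_apply, LinearMap.add_apply, add_mul, map_add]; abel
      map_smul' := fun c f => by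
        have : opBracket (c • f) P = c • opBracket f P := by
          ext y
          simp [opBracket_apply, smul_sub]
        rw [this]
        rfl }
  let δ : Derivation k O (Module.End k O ⧸ opLT k O n) := Derivation.mk' L fun f g => by
    change (opLT k O n).mkQ (opBracket (f * g) P) = f • (opLT k O n).mkQ (opBracket g P)
      + g • (opLT k O n).mkQ (opBracket f P)
    have : opBracket (f * g) P
        = f • opBracket g P + g • opBracket f P + opBracket g (opBracket f P) := by
      ext y
      simp only [opBracket_apply, LinearMap.add_apply, LinearMap.smul_apply, smul_eq_mul]
      rw [mul_assoc]
      ring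
    rw [this, map_add, map_add, map_smul, map_smul, add_eq_left]
    exact (Submodule.Quotient.mk_eq_zero _).2 (hP' f g)
  have := derivation_eq_sum hθ δ f
  change (opLT k O n).mkQ (opBracket f P) = ∑ j, θ j f • (opLT k O n).mkQ (opBracket (x j) P)
    at this
  rw [← Submodule.ker_mkQ (opLT k O n), LinearMap.mem_ker, map_sub, this]
  simp

/-- Euler's formula for symbols: an operator of order at most `n` is `1/n ∑ [P, x_j] θ_j` up to
lower order. -/
theorem nsmul_sub_sum_mem
    (hθ : ∀ f : O, KaehlerDifferential.D k O f = ∑ j, θ j f • KaehlerDifferential.D k O (x j))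
    {n : ℕ} {P : Module.End k O} (hP : P ∈ opLT k O (n + 1)) :
    n • P - ∑ j, opBracket (x j) P * (θ j : O →ₗ[k] O) ∈ opLT k O n := by
  induction n generalizing P with
  | zero =>
    have h0 : ∀ f, opBracket f P = 0 := fun f => (Submodule.mem_bot O).1 (mem_opLT_succ.1 hP f)
    simp [h0]
  | succ n ih =>
    rw [mem_opLT_succ]
    intro f
    have h1 := ih (mem_opLT_succ.1 hP f)
    have h2 := opBracket_sub_sum_mem hθ hP f
    have h3 : ∑ j, opBracket (θ j f) (opBracket (x j) P) ∈ opLT k O n :=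
      Submodule.sum_mem _ fun j _ => mem_opLT_succ.1 (mem_opLT_succ.1 hP _) _
    -- Bracketing with `f` reproduces the claim for `[P, f]`, of order one less. The extra copy of
    -- `[P, f]`, from `n + 1` against `n`, pairs with the terms where `f` meets `θ j`.
    have e : opBracket f ((n + 1) • P - ∑ j, opBracket (x j) P * (θ j : O →ₗ[k] O))
        = (n • opBracket f P - ∑ j, opBracket (x j) (opBracket f P) * (θ j : O →ₗ[k] O))
          + (opBracket f P - ∑ j, θ j f • opBracket (x j) P)
          - ∑ j, opBracket (θ j f) (opBracket (x j) P) := by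
      have e' : ∀ j, opBracket f (opBracket (x j) P * (θ j : O →ₗ[k] O))
          = opBracket (x j) (opBracket f P) * (θ j : O →ₗ[k] O)
            + θ j f • opBracket (x j) P + opBracket (θ j f) (opBracket (x j) P) := by
        intro j
        rw [opBracket_comm]
        ext y
        simp only [opBracket_apply, LinearMap.add_apply, LinearMap.smul_apply, smul_eq_mul,
          Module.End.mul_apply, Derivation.coeFn_coe, Derivation.leibniz, map_add]
        rw [mul_comm y (θ j f)]
        rw [mul_left_comm (x j) f]
        ring
      rw [map_sub, map_sum, Finset.sum_congr rfl fun j _ => e' j, map_nsmul, add_smul, one_smul]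
      simp only [Finset.sum_add_distrib]
      abel
    rw [e]
    exact Submodule.sub_mem _ (Submodule.add_mem _ h1 h2) h3

end DualBasis

/-- A differential operator, viewed as an endomorphism of `O`. -/
def DiffOp.toEnd : DiffOp k O →ₐ[k] Module.End k O := (diffOpSubalgebra k O).val

theorem DiffOp.toEnd_injective : Function.Injective (DiffOp.toEnd : DiffOp k O → Module.End k O) :=
  Subtype.val_injective

theorem DiffOp.smul_eq (f : O) (P : DiffOp k O) : f • P = DiffOp.ofFun k f * P := rfl

theorem DiffOp.toEnd_smul (f : O) (P : DiffOp k O) : (f • P).toEnd = f • P.toEnd := rfl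

@[simp]
theorem DiffOp.toEnd_ofFun (f y : O) : (DiffOp.ofFun k f).toEnd y = f * y := rfl

@[simp]
theorem DiffOp.toEnd_ofDer (θ : Derivation k O O) (y : O) : (DiffOp.ofDer θ).toEnd y = θ y := rfl

theorem DiffOp.exists_toEnd_mem_opLT (P : DiffOp k O) : ∃ n, P.toEnd ∈ opLT k O n := by
  obtain ⟨n, hn⟩ := P.2
  exact ⟨n + 1, hasDiffOrder_iff_mem_opLT.1 hn⟩

variable (k O) in
/-- The subring of `𝒟` generated by functions and vector fields. -/
def generatedDiffOp : Subring (DiffOp k O) :=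
  Subring.closure (Set.range (DiffOp.ofFun k) ∪ Set.range DiffOp.ofDer)

theorem ofFun_mem_generatedDiffOp (f : O) : DiffOp.ofFun k f ∈ generatedDiffOp k O :=
  Subring.subset_closure (Or.inl ⟨f, rfl⟩)

theorem ofDer_mem_generatedDiffOp (θ : Derivation k O O) :
    DiffOp.ofDer θ ∈ generatedDiffOp k O :=
  Subring.subset_closure (Or.inr ⟨θ, rfl⟩)

/-! ### Recovering operators from finitely many values -/

/-- The map `P ↦ P(y) Q`, for a function `y` and a differential operator `Q`. -/
def evalSMul (y : O) (Q : DiffOp k O) : Module.End k O →ₗ[O] DiffOp k O where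
  toFun P := P y • Q
  map_add' P P' := by rw [LinearMap.add_apply, add_smul]
  map_smul' f P := by rw [LinearMap.smul_apply, RingHom.id_apply, smul_assoc]

theorem evalSMul_apply (y : O) (Q : DiffOp k O) (P : Module.End k O) :
    evalSMul y Q P = P y • Q := rfl

variable (k O) in
/-- The `O`-span of the maps `P ↦ P(y) Q`, where `Q` is generated by functions and vector
fields. -/
def evalSpan : Submodule O (Module.End k O →ₗ[O] DiffOp k O) :=
  Submodule.span O {Φ | ∃ y : O, ∃ Q ∈ generatedDiffOp k O, Φ = evalSMul y Q}

theorem evalSMul_mem_evalSpan (y : O) {Q : DiffOp k O} (hQ : Q ∈ generatedDiffOp k O) :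
    evalSMul y Q ∈ evalSpan k O :=
  Submodule.subset_span ⟨y, Q, hQ, rfl⟩

/-- Values of a bracket are combinations of values of `P`: `[P, x](y) = P(xy) - x P(y)`. -/
theorem comp_opBracket_mem_evalSpan (x : O) {Φ : Module.End k O →ₗ[O] DiffOp k O}
    (hΦ : Φ ∈ evalSpan k O) : Φ ∘ₗ opBracket x ∈ evalSpan k O := by
  induction hΦ using Submodule.span_induction with
  | mem Φ h =>
    obtain ⟨y, Q, hQ, rfl⟩ := h
    have : evalSMul y Q ∘ₗ opBracket x = evalSMul (x * y) Q - x • evalSMul y Q := by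
      ext1 P
      simp only [LinearMap.comp_apply, evalSMul_apply, opBracket_apply, LinearMap.sub_apply,
        LinearMap.smul_apply, sub_smul, mul_smul]
    rw [this]
    exact Submodule.sub_mem _ (evalSMul_mem_evalSpan _ hQ)
      (Submodule.smul_mem _ _ (evalSMul_mem_evalSpan _ hQ))
  | zero => rw [LinearMap.zero_comp]; exact Submodule.zero_mem _
  | add Φ Ψ _ _ h h' => rw [LinearMap.add_comp]; exact Submodule.add_mem _ h h'
  | smul f Φ _ h => rw [LinearMap.smul_comp]; exact Submodule.smul_mem _ _ h

/-- Multiplication by an operator from the right. -/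
def opMulRight (R : Module.End k O) : Module.End k O →ₗ[O] Module.End k O where
  toFun P := P * R
  map_add' P P' := add_mul P P' R
  map_smul' _ _ := rfl

/-- Multiplication by a differential operator from the right. -/
def DiffOp.mulRight (R : DiffOp k O) : DiffOp k O →ₗ[O] DiffOp k O where
  toFun P := P * R
  map_add' P P' := add_mul P P' R
  map_smul' f P := mul_assoc (DiffOp.ofFun k f) P R

theorem comp_opMulRight_mem_evalSpan (R : Module.End k O) {Φ : Module.End k O →ₗ[O] DiffOp k O}
    (hΦ : Φ ∈ evalSpan k O) : Φ ∘ₗ opMulRight R ∈ evalSpan k O := by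
  induction hΦ using Submodule.span_induction with
  | mem Φ h =>
    obtain ⟨y, Q, hQ, rfl⟩ := h
    exact evalSMul_mem_evalSpan (R y) hQ
  | zero => rw [LinearMap.zero_comp]; exact Submodule.zero_mem _
  | add Φ Ψ _ _ h h' => rw [LinearMap.add_comp]; exact Submodule.add_mem _ h h'
  | smul f Φ _ h => rw [LinearMap.smul_comp]; exact Submodule.smul_mem _ _ h

theorem mulRight_comp_mem_evalSpan {R : DiffOp k O} (hR : R ∈ generatedDiffOp k O)
    {Φ : Module.End k O →ₗ[O] DiffOp k O} (hΦ : Φ ∈ evalSpan k O) :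
    DiffOp.mulRight R ∘ₗ Φ ∈ evalSpan k O := by
  induction hΦ using Submodule.span_induction with
  | mem Φ h =>
    obtain ⟨y, Q, hQ, rfl⟩ := h
    have : DiffOp.mulRight R ∘ₗ evalSMul y Q = evalSMul y (Q * R) := by
      ext1 P
      exact map_smul (DiffOp.mulRight R) (P y) Q
    rw [this]
    exact evalSMul_mem_evalSpan y (mul_mem hQ hR)
  | zero => rw [LinearMap.comp_zero]; exact Submodule.zero_mem _
  | add Φ Ψ _ _ h h' => rw [LinearMap.comp_add]; exact Submodule.add_mem _ h h'
  | smul f Φ _ h => rw [LinearMap.comp_smul]; exact Submodule.smul_mem _ _ h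

variable (k O) in
/-- Operators of bounded order are determined, in a way that is `O`-linear, by their values on
finitely many functions. -/
theorem exists_evalSpan_eq [CharZero k] [Algebra.Smooth k O] (n : ℕ) :
    ∃ Φ ∈ evalSpan k O, ∀ P ∈ opLT k O n, (Φ P).toEnd = P := by
  obtain ⟨J, _, x, θ, hθ⟩ := exists_dual_vectorFields k O
  induction n with
  | zero =>
    refine ⟨0, Submodule.zero_mem _, fun P hP => ?_⟩
    rw [(Submodule.mem_bot O).1 hP, LinearMap.zero_apply, map_zero]
  | succ n ih =>
    rcases Nat.eq_zero_or_pos n with rfl | hn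
    -- An operator of order zero is multiplication by its value at `1`.
    · refine ⟨evalSMul 1 1, evalSMul_mem_evalSpan 1 (one_mem _), fun P hP => ?_⟩
      ext y
      have h0 := LinearMap.congr_fun ((Submodule.mem_bot O).1 (mem_opLT_succ.1 hP y)) 1
      rw [opBracket_apply, LinearMap.zero_apply, sub_eq_zero, mul_one] at h0
      rw [evalSMul_apply, DiffOp.toEnd_smul, map_one DiffOp.toEnd, LinearMap.smul_apply,
        Module.End.one_apply, h0, smul_eq_mul, mul_comm]
    · obtain ⟨Φ, hΦ, h⟩ := ih
      let c : O := algebraMap k O (n : k)⁻¹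
      have hc : ∀ P : Module.End k O, c • n • P = P := fun P => by
        rw [← Nat.cast_smul_eq_nsmul O, smul_smul, ← map_natCast (algebraMap k O), ← map_mul,
          inv_mul_cancel₀ (Nat.cast_ne_zero.2 hn.ne'), map_one, one_smul]
      -- With `R = ∑ [P, x_j] θ_j`, split `P = R/n + (P - R/n)`. The brackets and the remainder `P -
      -- R/n` have lower order, so `Φ` recovers them.
      refine ⟨c • ∑ j, DiffOp.mulRight (DiffOp.ofDer (θ j)) ∘ₗ Φ ∘ₗ opBracket (x j)
          + (Φ - c • ∑ j, (Φ ∘ₗ opMulRight (θ j : O →ₗ[k] O)) ∘ₗ opBracket (x j)),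
        Submodule.add_mem _ (Submodule.smul_mem _ _ (Submodule.sum_mem _ fun j _ =>
          mulRight_comp_mem_evalSpan (ofDer_mem_generatedDiffOp _)
            (comp_opBracket_mem_evalSpan _ hΦ)))
          (Submodule.sub_mem _ hΦ (Submodule.smul_mem _ _ (Submodule.sum_mem _ fun j _ =>
            comp_opBracket_mem_evalSpan _ (comp_opMulRight_mem_evalSpan _ hΦ)))), fun P hP => ?_⟩
      have h1 := h _ (Submodule.smul_mem _ c (nsmul_sub_sum_mem hθ hP))
      have h2 : ∀ j, (DiffOp.mulRight (DiffOp.ofDer (θ j)) (Φ (opBracket (x j) P))).toEnd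
          = opBracket (x j) P * (θ j : O →ₗ[k] O) := fun j => by
        change (Φ (opBracket (x j) P) * DiffOp.ofDer (θ j)).toEnd = _
        rw [map_mul, h _ (mem_opLT_succ.1 hP _)]
        rfl
      rw [smul_sub, hc, map_sub, map_smul, map_sum] at h1
      simp only [LinearMap.add_apply, LinearMap.smul_apply, LinearMap.sum_apply,
        LinearMap.sub_apply, LinearMap.comp_apply, map_add, DiffOp.toEnd_smul, map_sum, h2]
      refine (congrArg _ h1).trans ?_
      abel

/-- `P = Φ(P)` is a sum `∑ f_i P(y_i) Q_i` with each `Q_i` in the generated subring. -/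
theorem generatedDiffOp_eq_top [CharZero k] [Algebra.Smooth k O] : generatedDiffOp k O = ⊤ := by
  rw [eq_top_iff]
  rintro P -
  obtain ⟨n, hn⟩ := P.exists_toEnd_mem_opLT
  obtain ⟨Φ, hΦ, h⟩ := exists_evalSpan_eq k O n
  rw [← DiffOp.toEnd_injective (h _ hn)]
  clear h hn
  -- Elements of `evalSpan` send every endomorphism into the generated subring; in this form the
  -- span induction applies.
  generalize P.toEnd = R
  induction hΦ using Submodule.span_induction with
  | mem Φ h =>
    obtain ⟨y, Q, hQ, rfl⟩ := h
    exact mul_mem (ofFun_mem_generatedDiffOp _) hQ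
  | zero => exact zero_mem _
  | add Φ Ψ _ _ h h' => exact add_mem h h'
  | smul f Φ _ h => exact mul_mem (ofFun_mem_generatedDiffOp _) h

/-- On a smooth algebra in characteristic zero, differential operators are generated by functions
and vector fields. -/
theorem DiffOp.induction [CharZero k] [Algebra.Smooth k O] {p : DiffOp k O → Prop}
    (ofFun : ∀ f : O, p (DiffOp.ofFun k f)) (ofDer : ∀ θ : Derivation k O O, p (DiffOp.ofDer θ))
    (add : ∀ P Q, p P → p Q → p (P + Q)) (mul : ∀ P Q, p P → p Q → p (P * Q))
    (P : DiffOp k O) : p P := by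
  have hP : P ∈ generatedDiffOp k O := by rw [generatedDiffOp_eq_top]; trivial
  induction hP using Subring.closure_induction with
  | mem P h =>
    rcases h with ⟨f, rfl⟩ | ⟨θ, rfl⟩
    · exact ofFun f
    · exact ofDer θ
  | zero => simpa using ofFun 0
  | one => simpa using ofFun 1
  | add P Q _ _ h h' => exact add P Q h h'
  | neg P _ h =>
    have := mul _ _ (ofFun (-1)) h
    rwa [map_neg, map_one, neg_one_mul] at this
  | mul P Q _ _ h h' => exact mul P Q h h'

/-! ### Embedding `M ⊗_O 𝒟` into functions -/

section Evaluation

variable (k O) in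
/-- The map `M ⊗_O 𝒟 → (O → M)`, `a ⊗ P ↦ (f ↦ P(f) a)`. -/
noncomputable def evalTensor (M : Type u) [AddCommGroup M] [Module O M] :
    M ⊗[O] DiffOp k O →ₗ[O] (O → M) :=
  TensorProduct.lift
    { toFun := fun a =>
        { toFun := fun P f => P.toEnd f • a
          map_add' := fun P Q => by
            ext f
            simp [add_smul]
          map_smul' := fun g P => by
            ext f
            simp [DiffOp.toEnd_smul, mul_smul] }
      map_add' := fun a b => by
        ext P f
        exact smul_add _ _ _
      map_smul' := fun g a => by
        ext P f
        exact smul_comm _ _ _ }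

theorem evalTensor_tmul {M : Type u} [AddCommGroup M] [Module O M] (a : M) (P : DiffOp k O)
    (f : O) : evalTensor k O M (a ⊗ₜ P) f = P.toEnd f • a := rfl

/-- For `Φ(P) = P(y) Q` one has `a ⊗ Φ(P) = P(y) a ⊗ Q`, which depends only on the function `f ↦
P(f) a`. -/
theorem exists_comp_evalTensor {M : Type u} [AddCommGroup M] [Module O M]
    {Φ : Module.End k O →ₗ[O] DiffOp k O} (hΦ : Φ ∈ evalSpan k O) :
    ∃ Ψ : (O → M) →ₗ[O] M ⊗[O] DiffOp k O, ∀ (a : M) (P : DiffOp k O),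
      Ψ (evalTensor k O M (a ⊗ₜ P)) = a ⊗ₜ Φ P.toEnd := by
  induction hΦ using Submodule.span_induction with
  | mem Φ h =>
    obtain ⟨y, Q, hQ, rfl⟩ := h
    refine ⟨(TensorProduct.mk O M (DiffOp k O)).flip Q ∘ₗ LinearMap.proj y, fun a P => ?_⟩
    simp [evalTensor_tmul, evalSMul_apply]
  | zero => exact ⟨0, fun a P => by simp⟩
  | add Φ Φ' _ _ h h' =>
    obtain ⟨Ψ, h⟩ := h
    obtain ⟨Ψ', h'⟩ := h'
    exact ⟨Ψ + Ψ', fun a P => by simp [h, h', TensorProduct.tmul_add]⟩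
  | smul f Φ _ h =>
    obtain ⟨Ψ, h⟩ := h
    exact ⟨f • Ψ, fun a P => by simp [h]⟩

theorem evalTensor_injective [CharZero k] [Algebra.Smooth k O] (M : Type u) [AddCommGroup M]
    [Module O M] : Function.Injective (evalTensor k O M) := by
  -- A tensor involves finitely many operators, hence a bounded order `n`. A `Φ` that recovers
  -- operators of that order gives a left inverse `Ψ` at `t`.
  have key : ∀ t : M ⊗[O] DiffOp k O, ∃ n, ∀ (Φ : Module.End k O →ₗ[O] DiffOp k O)
      (Ψ : (O → M) →ₗ[O] M ⊗[O] DiffOp k O), (∀ P ∈ opLT k O n, (Φ P).toEnd = P) →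
      (∀ (a : M) (P : DiffOp k O), Ψ (evalTensor k O M (a ⊗ₜ P)) = a ⊗ₜ Φ P.toEnd) →
      Ψ (evalTensor k O M t) = t := by
    intro t
    induction t with
    | zero => exact ⟨0, fun Φ Ψ _ _ => by simp⟩
    | tmul a P =>
      obtain ⟨n, hn⟩ := P.exists_toEnd_mem_opLT
      refine ⟨n, fun Φ Ψ h h' => ?_⟩
      rw [h', DiffOp.toEnd_injective (h _ hn)]
    | add s t hs ht =>
      obtain ⟨m, hm⟩ := hs
      obtain ⟨n, hn⟩ := ht
      refine ⟨max m n, fun Φ Ψ h h' => ?_⟩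
      rw [map_add, map_add, hm Φ Ψ (fun P hP => h P (opLT_mono (le_max_left m n) hP)) h',
        hn Φ Ψ (fun P hP => h P (opLT_mono (le_max_right m n) hP)) h']
  rw [injective_iff_map_eq_zero]
  intro t ht
  obtain ⟨n, hn⟩ := key t
  obtain ⟨Φ, hΦ, h⟩ := exists_evalSpan_eq k O n
  obtain ⟨Ψ, hΨ⟩ := exists_comp_evalTensor (M := M) hΦ
  rw [← hn Φ Ψ h hΨ, ht, map_zero]

end Evaluation

end Generation

/-! ### The `𝒟`-module `A ⊗_O V` -/

section FreeModule

variable {k : Type v} {O : Type u} [Field k] [CommRing O] [Algebra k O]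

theorem DiffOp.ofFun_smul {M : Type*} [AddCommGroup M] [Module O M] [Module (DiffOp k O) M]
    [IsScalarTower O (DiffOp k O) M] (f : O) (m : M) : DiffOp.ofFun k f • m = f • m := by
  rw [← mul_one (DiffOp.ofFun k f), ← DiffOp.smul_eq, smul_assoc, one_smul]

theorem DiffOp.ofDer_mul_ofFun (θ : Derivation k O O) (f : O) :
    DiffOp.ofDer θ * DiffOp.ofFun k f
      = DiffOp.ofFun k f * DiffOp.ofDer θ + DiffOp.ofFun k (θ f) := by
  apply DiffOp.toEnd_injective
  ext y
  simp [mul_comm]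

theorem DiffOp.ofDer_smul_smul {M : Type*} [AddCommGroup M] [Module O M] [Module (DiffOp k O) M]
    [IsScalarTower O (DiffOp k O) M] (θ : Derivation k O O) (f : O) (m : M) :
    DiffOp.ofDer θ • f • m = f • DiffOp.ofDer θ • m + θ f • m := by
  rw [← DiffOp.ofFun_smul (k := k) f, smul_smul, DiffOp.ofDer_mul_ofFun, add_smul, mul_smul,
    DiffOp.ofFun_smul, DiffOp.ofFun_smul]

theorem DGDAlg.ofDer_smul_one (A : DGDAlg k O) (θ : Derivation k O O) :
    DiffOp.ofDer θ • (1 : A.carrier) = 0 := by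
  have := A.der_mul θ 1 1
  rw [mul_one, one_mul, mul_one] at this
  exact left_eq_add.1 this

variable (A : DGDAlg k O) (ι : Type u)

/-- The underlying `A`-module of the free object on the graded set `ι`. -/
abbrev FreeCarrier : Type u := A.carrier ⊗[O] (ι →₀ DiffOp k O)

/-- The map `A ⊗_O V → (ι → O → A)`, `a ⊗ ∑ P_i e_i ↦ (f ↦ P_i(f) a)_i`. -/
noncomputable def evalFree : FreeCarrier A ι →ₗ[O] (ι → O → A.carrier) :=
  LinearMap.pi fun i =>
    evalTensor k O A.carrier ∘ₗ LinearMap.lTensor A.carrier (Finsupp.lapply i)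

variable {A ι}

theorem evalFree_tmul (a : A.carrier) (w : ι →₀ DiffOp k O) (i : ι) (f : O) :
    evalFree A ι (a ⊗ₜ w) i f = (w i).toEnd f • a := rfl

/-- In each coordinate this is `θ(w_i(f) a) = w_i(f) θ(a) + θ(w_i(f)) a`: the Leibniz action on the
tensor product becomes the pointwise action on functions. -/
theorem evalFree_ofDer_tmul (θ : Derivation k O O) (a : A.carrier) (w : ι →₀ DiffOp k O) :
    evalFree A ι ((DiffOp.ofDer θ • a) ⊗ₜ w + a ⊗ₜ (DiffOp.ofDer θ • w))
      = DiffOp.ofDer θ • evalFree A ι (a ⊗ₜ w) := by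
  ext i f
  rw [map_add]
  simp only [Pi.add_apply, Pi.smul_apply, evalFree_tmul, DiffOp.ofDer_smul_smul,
    Finsupp.smul_apply, smul_eq_mul, map_mul, Module.End.mul_apply, DiffOp.toEnd_ofDer]

variable [CharZero k] [Algebra.Smooth k O]

theorem evalFree_injective : Function.Injective (evalFree A ι) := by
  classical
  rw [injective_iff_map_eq_zero]
  intro t ht
  apply (TensorProduct.finsuppRight O O A.carrier (DiffOp k O) ι).injective
  rw [map_zero]
  ext i
  rw [TensorProduct.finsuppRight_apply, Finsupp.zero_apply]
  apply evalTensor_injective (k := k)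
  rw [map_zero]
  exact congrFun ht i

/-- The image of `evalFree` is stable under functions and vector fields, hence under all of `𝒟`.
This defines an action without checking the relations of `𝒟` on tensors. -/
theorem exists_evalFree_eq_smul (P : DiffOp k O) (t : FreeCarrier A ι) :
    ∃ t', evalFree A ι t' = P • evalFree A ι t := by
  induction P using DiffOp.induction generalizing t with
  | ofFun f => exact ⟨f • t, by rw [DiffOp.ofFun_smul, map_smul]⟩
  | ofDer θ =>
    induction t using TensorProduct.induction_on with
    | zero => exact ⟨0, by simp⟩
    | tmul a w => exact ⟨_, evalFree_ofDer_tmul θ a w⟩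
    | add s t hs ht =>
      obtain ⟨s', hs⟩ := hs
      obtain ⟨t', ht⟩ := ht
      exact ⟨s' + t', by rw [map_add, map_add, smul_add, hs, ht]⟩
  | add P Q hP hQ =>
    obtain ⟨s, hs⟩ := hP t
    obtain ⟨s', hs'⟩ := hQ t
    exact ⟨s + s', by rw [map_add, hs, hs', add_smul]⟩
  | mul P Q hP hQ =>
    obtain ⟨s, hs⟩ := hQ t
    obtain ⟨s', hs'⟩ := hP s
    exact ⟨s', by rw [hs', hs, mul_smul]⟩

/-- The `𝒟`-action on `A ⊗_O V`. It is the restriction of the pointwise action on functions with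
values in `A`. -/
noncomputable def FreeCarrier.act (P : DiffOp k O) (t : FreeCarrier A ι) : FreeCarrier A ι :=
  (exists_evalFree_eq_smul P t).choose

theorem evalFree_act (P : DiffOp k O) (t : FreeCarrier A ι) :
    evalFree A ι (FreeCarrier.act P t) = P • evalFree A ι t :=
  (exists_evalFree_eq_smul P t).choose_spec

noncomputable instance FreeCarrier.instModule : Module (DiffOp k O) (FreeCarrier A ι) where
  smul := FreeCarrier.act
  one_smul t := evalFree_injective ((evalFree_act _ _).trans (one_smul _ _))
  mul_smul P Q t := evalFree_injective <| (evalFree_act _ _).trans <| by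
    rw [mul_smul, ← evalFree_act Q]
    exact (evalFree_act _ _).symm
  smul_zero P := evalFree_injective <| (evalFree_act _ _).trans <| by rw [map_zero, smul_zero]
  smul_add P s t := evalFree_injective <| (evalFree_act _ _).trans <| by
    rw [map_add, map_add, smul_add, ← evalFree_act, ← evalFree_act]
    rfl
  add_smul P Q t := evalFree_injective <| (evalFree_act _ _).trans <| by
    rw [map_add, add_smul, ← evalFree_act, ← evalFree_act]
    rfl
  zero_smul t := evalFree_injective <| (evalFree_act _ _).trans <| by rw [map_zero, zero_smul]

theorem evalFree_smul (P : DiffOp k O) (t : FreeCarrier A ι) :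
    evalFree A ι (P • t) = P • evalFree A ι t := evalFree_act P t

instance FreeCarrier.instIsScalarTower :
    IsScalarTower O (DiffOp k O) (FreeCarrier A ι) where
  smul_assoc f P t := evalFree_injective (by
    rw [evalFree_smul, map_smul, evalFree_smul, smul_assoc])

/-- Vector fields act on `A ⊗_O V` by the Leibniz rule. -/
theorem FreeCarrier.ofDer_smul_tmul (θ : Derivation k O O) (a : A.carrier)
    (w : ι →₀ DiffOp k O) : DiffOp.ofDer θ • (a ⊗ₜ w : FreeCarrier A ι)
      = (DiffOp.ofDer θ • a) ⊗ₜ w + a ⊗ₜ (DiffOp.ofDer θ • w) :=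
  evalFree_injective (by rw [evalFree_smul, evalFree_ofDer_tmul])

theorem FreeCarrier.ofDer_smul_smul (θ : Derivation k O O) (a : A.carrier)
    (t : FreeCarrier A ι) :
    DiffOp.ofDer θ • a • t = (DiffOp.ofDer θ • a) • t + a • DiffOp.ofDer θ • t := by
  induction t using TensorProduct.induction_on with
  | zero => simp
  | tmul b w =>
    simp only [TensorProduct.smul_tmul', smul_eq_mul, FreeCarrier.ofDer_smul_tmul, A.der_mul,
      TensorProduct.add_tmul, smul_add, add_assoc]
  | add s t hs ht =>
    simp only [smul_add, hs, ht]
    abel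

/-- A map that is compatible with functions and vector fields is `𝒟`-linear. -/
def linearMapOfDer {M N : Type*} [AddCommGroup M] [AddCommGroup N] [Module O M] [Module O N]
    [Module (DiffOp k O) M] [Module (DiffOp k O) N] [IsScalarTower O (DiffOp k O) M]
    [IsScalarTower O (DiffOp k O) N] (h : M →ₗ[O] N)
    (hθ : ∀ (θ : Derivation k O O) (m : M), h (DiffOp.ofDer θ • m) = DiffOp.ofDer θ • h m) :
    M →ₗ[DiffOp k O] N where
  toFun := h
  map_add' := h.map_add
  map_smul' P m := by
    rw [RingHom.id_apply]
    induction P using DiffOp.induction generalizing m with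
    | ofFun f => rw [DiffOp.ofFun_smul, DiffOp.ofFun_smul, map_smul]
    | ofDer θ => exact hθ θ m
    | add P Q hP hQ => rw [add_smul, map_add, hP, hQ, add_smul]
    | mul P Q hP hQ => rw [mul_smul, hP, hQ, mul_smul]

section Lift

variable {M : Type*} [AddCommGroup M] [Module O M] [Module (DiffOp k O) M]
  [IsScalarTower O (DiffOp k O) M] [Module A.carrier M] [IsScalarTower O A.carrier M]
  (hM : ∀ (θ : Derivation k O O) (a : A.carrier) (m : M),
    DiffOp.ofDer θ • (a • m) = (DiffOp.ofDer θ • a) • m + a • (DiffOp.ofDer θ • m))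

/-- The `𝒟`-linear map `A ⊗_O V → M` given by the images of the basis of `V`. -/
noncomputable def freeLift (m : ι → M) : FreeCarrier A ι →ₗ[DiffOp k O] M :=
  linearMapOfDer
    (TensorProduct.lift ((Algebra.lsmul O O M).toLinearMap.compl₂
      ((Finsupp.linearCombination (DiffOp k O) m).restrictScalars O))) <| by
    intro θ t
    induction t using TensorProduct.induction_on with
    | zero => simp
    | tmul a w => simp [FreeCarrier.ofDer_smul_tmul, hM]
    | add s t hs ht => rw [smul_add, map_add, hs, ht, map_add, smul_add]

theorem freeLift_tmul (m : ι → M) (a : A.carrier) (w : ι →₀ DiffOp k O) :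
    freeLift hM m (a ⊗ₜ w) = a • Finsupp.linearCombination (DiffOp k O) m w := rfl

theorem freeLift_tmul_single (m : ι → M) (a : A.carrier) (i : ι) :
    freeLift hM m (a ⊗ₜ Finsupp.single i 1) = a • m i := by
  rw [freeLift_tmul, Finsupp.linearCombination_single, one_smul]

theorem freeLift_smul (m : ι → M) (a : A.carrier) (t : FreeCarrier A ι) :
    freeLift hM m (a • t) = a • freeLift hM m t := by
  induction t using TensorProduct.induction_on with
  | zero => simp
  | tmul b w => rw [TensorProduct.smul_tmul', freeLift_tmul, freeLift_tmul, smul_smul, smul_eq_mul]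
  | add s t hs ht => rw [smul_add, map_add, hs, ht, map_add, smul_add]

end Lift

/-- The map `φ ⊗ 1` on `A ⊗_O V`, for a `𝒟`-linear endomorphism `φ` of `A`. -/
noncomputable def mapCoeff (φ : A.carrier →ₗ[DiffOp k O] A.carrier) :
    FreeCarrier A ι →ₗ[DiffOp k O] FreeCarrier A ι :=
  linearMapOfDer (LinearMap.rTensor _ (φ.restrictScalars O)) <| by
    intro θ t
    induction t using TensorProduct.induction_on with
    | zero => simp
    | tmul a w => simp [FreeCarrier.ofDer_smul_tmul]
    | add s t hs ht => rw [smul_add, map_add, hs, ht, map_add, smul_add]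

/-- `A ⊗_O V` is spanned over `𝒟` by the elements `a ⊗ e_i`. -/
theorem FreeCarrier.eq_top_of_tmul_single_mem (T : Submodule (DiffOp k O) (FreeCarrier A ι))
    (h : ∀ (a : A.carrier) (i : ι), a ⊗ₜ Finsupp.single i 1 ∈ T) : T = ⊤ := by
  -- Operators move out of the right factor by `a ⊗ θw = θ(a ⊗ w) - θa ⊗ w`. The statement ranges
  -- over all `a` because `θ` falls on `a`.
  have key : ∀ (P : DiffOp k O) (w : ι →₀ DiffOp k O), (∀ a : A.carrier, a ⊗ₜ w ∈ T) →
      ∀ a : A.carrier, a ⊗ₜ (P • w) ∈ T := by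
    intro P
    induction P using DiffOp.induction with
    | ofFun f =>
      intro w hw a
      rw [DiffOp.ofFun_smul, ← TensorProduct.smul_tmul]
      exact hw _
    | ofDer θ =>
      intro w hw a
      rw [← add_sub_cancel_left ((DiffOp.ofDer θ • a) ⊗ₜ[O] w) (a ⊗ₜ (DiffOp.ofDer θ • w)),
        ← FreeCarrier.ofDer_smul_tmul]
      exact T.sub_mem (T.smul_mem _ (hw a)) (hw _)
    | add P Q hP hQ =>
      intro w hw a
      rw [add_smul, TensorProduct.tmul_add]
      exact T.add_mem (hP w hw a) (hQ w hw a)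
    | mul P Q hP hQ =>
      intro w hw a
      rw [mul_smul]
      exact hP _ (hQ w hw) a
  rw [eq_top_iff]
  rintro t -
  induction t using TensorProduct.induction_on with
  | zero => exact T.zero_mem
  | tmul a w =>
    induction w using Finsupp.induction_linear with
    | zero => rw [TensorProduct.tmul_zero]; exact T.zero_mem
    | add v w hv hw => rw [TensorProduct.tmul_add]; exact T.add_mem hv hw
    | single i P =>
      rw [← mul_one P, ← smul_eq_mul, ← Finsupp.smul_single]
      exact key P _ (fun a => h a i) a
  | add s t hs ht => exact T.add_mem hs ht

end FreeModule

/-! ### Internal gradings -/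

section Grading

variable {R M : Type*} [Ring R] [AddCommGroup M] [Module R M] {gr : ℕ → Submodule R M}
  (h : DirectSum.IsInternal gr)

/-- The linear map on a graded module given by its restrictions to the homogeneous components. -/
noncomputable def gradedLift {N : Type*} [AddCommGroup N] [Module R N] (c : ∀ n, gr n →ₗ[R] N) :
    M →ₗ[R] N :=
  DirectSum.toModule R ℕ N c ∘ₗ
    (LinearEquiv.ofBijective (DirectSum.coeLinearMap gr) h).symm.toLinearMap

theorem gradedLift_of_mem {N : Type*} [AddCommGroup N] [Module R N] (c : ∀ n, gr n →ₗ[R] N)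
    {n : ℕ} {x : M} (hx : x ∈ gr n) : gradedLift h c x = c n ⟨x, hx⟩ := by
  have : (LinearEquiv.ofBijective (DirectSum.coeLinearMap gr) h).symm x
      = DirectSum.lof R ℕ (fun n => gr n) n ⟨x, hx⟩ := by
    rw [LinearEquiv.symm_apply_eq]
    exact (DirectSum.coeLinearMap_lof gr n ⟨x, hx⟩).symm
  rw [gradedLift, LinearMap.comp_apply, LinearEquiv.coe_coe, this, DirectSum.toModule_lof]

/-- The projection to a homogeneous component. -/
noncomputable def gradedProj (n : ℕ) : M →ₗ[R] M :=
  gradedLift h fun m => if m = n then (gr m).subtype else 0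

theorem gradedProj_of_mem {n : ℕ} {x : M} (hx : x ∈ gr n) : gradedProj h n x = x := by
  rw [gradedProj, gradedLift_of_mem h _ hx, if_pos rfl]
  rfl

theorem gradedProj_of_mem_ne {m n : ℕ} {x : M} (hx : x ∈ gr m) (hmn : m ≠ n) :
    gradedProj h n x = 0 := by
  rw [gradedProj, gradedLift_of_mem h _ hx, if_neg hmn]
  rfl

theorem graded_induction (h : DirectSum.IsInternal gr) {p : M → Prop} (hom : ∀ n, ∀ x ∈ gr n, p x)
    (add : ∀ x y, p x → p y → p (x + y)) (x : M) : p x := by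
  have hx : x ∈ ⨆ n, gr n := by rw [h.submodule_iSup_eq_top]; trivial
  induction hx using Submodule.iSup_induction' with
  | mem n x hx => exact hom n x hx
  | zero => exact hom 0 0 (Submodule.zero_mem _)
  | add x y _ _ hx hy => exact add x y hx hy

theorem gradedProj_mem (n : ℕ) (x : M) : gradedProj h n x ∈ gr n := by
  induction x using graded_induction h with
  | hom m x hx =>
    by_cases hmn : m = n
    · subst hmn
      rwa [gradedProj_of_mem h hx]
    · rw [gradedProj_of_mem_ne h hx hmn]
      exact Submodule.zero_mem _
  | add x y hx hy =>
    rw [map_add]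
    exact Submodule.add_mem _ hx hy

theorem exists_sum_gradedProj (x : M) :
    ∃ s : Finset ℕ, ∀ s', s ⊆ s' → ∑ n ∈ s', gradedProj h n x = x := by
  induction x using graded_induction h with
  | hom m x hx =>
    refine ⟨{m}, fun s' hs' => ?_⟩
    rw [Finset.sum_eq_single_of_mem m (hs' (Finset.mem_singleton_self m))
      fun n _ hn => gradedProj_of_mem_ne h hx hn.symm, gradedProj_of_mem h hx]
  | add x y hx hy =>
    obtain ⟨s, hs⟩ := hx
    obtain ⟨t, ht⟩ := hy
    refine ⟨s ∪ t, fun s' hs' => ?_⟩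
    simp only [map_add, Finset.sum_add_distrib]
    rw [hs s' (Finset.union_subset_left hs'), ht s' (Finset.union_subset_right hs')]

theorem mem_of_gradedProj_mem {T : Submodule R M} {x : M} (hx : ∀ n, gradedProj h n x ∈ T) :
    x ∈ T := by
  obtain ⟨s, hs⟩ := exists_sum_gradedProj h x
  rw [← hs s subset_rfl]
  exact Submodule.sum_mem _ fun n _ => hx n

/-- The involution of a graded module that is `(-1)^n` in degree `n`. -/
noncomputable def gradedSign : M →ₗ[R] M := gradedLift h fun n => (-1 : ℤ) ^ n • (gr n).subtype

theorem gradedSign_of_mem {n : ℕ} {x : M} (hx : x ∈ gr n) :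
    gradedSign h x = (-1 : ℤ) ^ n • x := by
  rw [gradedSign, gradedLift_of_mem h _ hx]
  rfl

end Grading

/-! ### Semi-free modules: grading and differential -/

section FreeDGDMod

variable {k : Type v} {O : Type u} [Field k] [CommRing O] [Algebra k O]

theorem DGDAlg.gradedSign_mul (A : DGDAlg k O) {i : ℕ} {a : A.carrier} (ha : a ∈ A.gr i)
    (b : A.carrier) :
    gradedSign A.isInternal (a * b) = (-1 : ℤ) ^ i • (a * gradedSign A.isInternal b) := by
  induction b using graded_induction A.isInternal with
  | hom j b hb =>
    rw [gradedSign_of_mem A.isInternal (A.mul_mem ha hb), gradedSign_of_mem A.isInternal hb,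
      mul_smul_comm, smul_smul, pow_add]
  | add b c hb hc => rw [mul_add, map_add, hb, hc, map_add, mul_add, smul_add]

variable [CharZero k] [Algebra.Smooth k O] {A : DGDAlg k O} {ι : Type u}

/-- The elements that `W` multiplies into `T` form a `𝒟`-submodule, by the Leibniz rule and the
stability of `W` under vector fields. -/
theorem smul_smul_mem {M : Type*} [AddCommGroup M] [Module O M] [Module (DiffOp k O) M]
    [IsScalarTower O (DiffOp k O) M] [Module A.carrier M] [IsScalarTower O A.carrier M]
    (hM : ∀ (θ : Derivation k O O) (a : A.carrier) (m : M),
      DiffOp.ofDer θ • (a • m) = (DiffOp.ofDer θ • a) • m + a • (DiffOp.ofDer θ • m))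
    {W : Submodule (DiffOp k O) A.carrier} {T : Submodule (DiffOp k O) M} {t : M}
    (h : ∀ a ∈ W, a • t ∈ T) (P : DiffOp k O) : ∀ a ∈ W, a • P • t ∈ T := by
  induction P using DiffOp.induction generalizing t with
  | ofFun f =>
    intro a ha
    rw [DiffOp.ofFun_smul, smul_algebra_smul_comm, ← DiffOp.ofFun_smul (k := k)]
    exact T.smul_mem _ (h a ha)
  | ofDer θ =>
    intro a ha
    rw [← add_sub_cancel_left ((DiffOp.ofDer θ • a) • t) (a • DiffOp.ofDer θ • t), ← hM]
    exact T.sub_mem (T.smul_mem _ (h a ha)) (h _ (W.smul_mem _ ha))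
  | add P Q hP hQ =>
    intro a ha
    rw [add_smul, smul_add]
    exact T.add_mem (hP h a ha) (hQ h a ha)
  | mul P Q hP hQ =>
    rw [mul_smul]
    exact hP (hQ h)

/-- The component of degree `n` of `A ⊗_O V`, where the basis element `e_i` of `V` has degree
`deg i`. -/
noncomputable def freeGr (A : DGDAlg k O) (deg : ι → ℕ) (n : ℕ) : Submodule (DiffOp k O) (FreeCarrier A ι) :=
  Submodule.span (DiffOp k O)
    {t | ∃ (j : ℕ) (a : A.carrier) (i : ι), a ∈ A.gr j ∧ j + deg i = n ∧
      t = a ⊗ₜ Finsupp.single i 1}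

theorem tmul_single_mem_freeGr {deg : ι → ℕ} {j n : ℕ} {a : A.carrier} (ha : a ∈ A.gr j) {i : ι}
    (hn : j + deg i = n) : a ⊗ₜ Finsupp.single i 1 ∈ freeGr A deg n :=
  Submodule.subset_span ⟨j, a, i, ha, hn, rfl⟩

theorem smul_mem_freeGr {deg : ι → ℕ} {i j : ℕ} {a : A.carrier} {t : FreeCarrier A ι}
    (ha : a ∈ A.gr i) (ht : t ∈ freeGr A deg j) : a • t ∈ freeGr A deg (i + j) := by
  suffices ∀ a ∈ A.gr i, a • t ∈ freeGr A deg (i + j) from this a ha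
  clear ha a
  induction ht using Submodule.span_induction with
  | mem t h =>
    obtain ⟨l, b, s, hb, hl, rfl⟩ := h
    intro a ha
    rw [TensorProduct.smul_tmul']
    exact tmul_single_mem_freeGr (A.mul_mem ha hb) (by omega)
  | zero => intro a _; rw [smul_zero]; exact Submodule.zero_mem _
  | add s t _ _ hs ht => intro a ha; rw [smul_add]; exact Submodule.add_mem _ (hs a ha) (ht a ha)
  | smul P t _ ht => exact smul_smul_mem FreeCarrier.ofDer_smul_smul ht P

theorem iSup_freeGr (deg : ι → ℕ) : ⨆ n, freeGr A deg n = ⊤ := by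
  apply FreeCarrier.eq_top_of_tmul_single_mem
  intro a i
  induction a using graded_induction A.isInternal with
  | hom j a ha => exact Submodule.mem_iSup_of_mem _ (tmul_single_mem_freeGr ha rfl)
  | add a b ha hb => rw [TensorProduct.add_tmul]; exact Submodule.add_mem _ ha hb

/-- Degrees are visible after evaluation: the `i`-th coordinate of an element of degree `n` has only
a component of degree `n - deg i`, since `𝒟` preserves degrees in `A`. -/
theorem gradedProj_evalFree_of_mem_freeGr {deg : ι → ℕ} {n j : ℕ} {t : FreeCarrier A ι}
    (ht : t ∈ freeGr A deg n) (i : ι) (hn : j + deg i ≠ n) (f : O) :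
    gradedProj A.isInternal j (evalFree A ι t i f) = 0 := by
  induction ht using Submodule.span_induction with
  | mem t h =>
    obtain ⟨l, b, s, hb, hl, rfl⟩ := h
    rw [evalFree_tmul]
    by_cases hs : s = i
    · subst hs
      refine gradedProj_of_mem_ne A.isInternal (m := l) ?_ (by omega)
      have := (A.gr l).smul_mem (DiffOp.ofFun k ((Finsupp.single s 1 s : DiffOp k O).toEnd f)) hb
      rwa [DiffOp.ofFun_smul] at this
    · rw [Finsupp.single_eq_of_ne' hs, map_zero, LinearMap.zero_apply, zero_smul, map_zero]
  | zero => simp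
  | add s t _ _ hs ht => simp [hs, ht]
  | smul P t _ ht =>
    rw [evalFree_smul, Pi.smul_apply, Pi.smul_apply, map_smul, ht, smul_zero]

/-- An element of degree `n` that is also a sum of elements of other degrees has all coordinate
components zero, so it vanishes by injectivity of `evalFree`. -/
theorem freeGr_isInternal (deg : ι → ℕ) : DirectSum.IsInternal (freeGr A deg) := by
  refine DirectSum.isInternal_submodule_of_iSupIndep_of_iSup_eq_top ?_ (iSup_freeGr deg)
  intro n
  rw [Submodule.disjoint_def]
  intro t ht ht'
  apply evalFree_injective
  rw [map_zero]
  ext i f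
  rw [Pi.zero_apply, Pi.zero_apply, ← Submodule.mem_bot (DiffOp k O)]
  refine mem_of_gradedProj_mem A.isInternal fun j => ?_
  rw [Submodule.mem_bot]
  by_cases hj : j + deg i = n
  · clear ht
    induction ht' using Submodule.iSup_induction' with
    | mem m t h =>
      by_cases hm : m ≠ n
      · simp only [hm, ne_eq, not_false_eq_true, iSup_pos] at h
        exact gradedProj_evalFree_of_mem_freeGr h i (by omega) f
      · simp only [hm, iSup_false, Submodule.mem_bot] at h
        simp [h]
    | zero => simp
    | add s t _ _ hs ht => simp [hs, ht]
  · exact gradedProj_evalFree_of_mem_freeGr ht i hj f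

/-- The differential of `A ⊗_O V` for which `d e_i = δ i`. -/
noncomputable def freeDiff (δ : ι → FreeCarrier A ι) :
    FreeCarrier A ι →ₗ[DiffOp k O] FreeCarrier A ι :=
  mapCoeff A.d + freeLift FreeCarrier.ofDer_smul_smul δ ∘ₗ mapCoeff (gradedSign A.isInternal)

theorem freeDiff_tmul (δ : ι → FreeCarrier A ι) (a : A.carrier) (w : ι →₀ DiffOp k O) :
    freeDiff δ (a ⊗ₜ w) = A.d a ⊗ₜ w
      + gradedSign A.isInternal a • Finsupp.linearCombination (DiffOp k O) δ w := rfl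

theorem freeDiff_tmul_single (δ : ι → FreeCarrier A ι) (a : A.carrier) (i : ι) :
    freeDiff δ (a ⊗ₜ Finsupp.single i 1) = A.d a ⊗ₜ Finsupp.single i 1
      + gradedSign A.isInternal a • δ i := by
  rw [freeDiff_tmul, Finsupp.linearCombination_single, one_smul]

theorem freeDiff_smul (δ : ι → FreeCarrier A ι) {i : ℕ} {a : A.carrier} (t : FreeCarrier A ι)
    (ha : a ∈ A.gr i) :
    freeDiff δ (a • t) = A.d a • t + ((-1 : ℤ) ^ i • a) • freeDiff δ t := by
  induction t using TensorProduct.induction_on with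
  | zero => simp
  | tmul b w =>
    rw [TensorProduct.smul_tmul', smul_eq_mul, freeDiff_tmul, freeDiff_tmul, A.d_mul b ha,
      A.gradedSign_mul ha, ← smul_mul_assoc, ← smul_mul_assoc, TensorProduct.add_tmul, smul_add,
      TensorProduct.smul_tmul', TensorProduct.smul_tmul', mul_smul, smul_eq_mul, smul_eq_mul,
      add_assoc]
  | add s t hs ht =>
    rw [smul_add, map_add, hs, ht, map_add]
    simp only [smul_add]
    abel

/-- The conditions under which elements `δ i` are the differentials of the basis elements in a
semi-free `A`-module. -/
structure IsAttaching (deg : ι → ℕ) (δ : ι → FreeCarrier A ι) : Prop where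
  eq_zero : ∀ i, deg i = 0 → δ i = 0
  mem : ∀ i n, deg i = n + 1 → δ i ∈ freeGr A deg n
  cycle : ∀ i, freeDiff δ (δ i) = 0

variable {deg : ι → ℕ} {δ : ι → FreeCarrier A ι}

theorem IsAttaching.freeDiff_mem (h : IsAttaching deg δ) {n : ℕ} {t : FreeCarrier A ι}
    (ht : t ∈ freeGr A deg (n + 1)) : freeDiff δ t ∈ freeGr A deg n := by
  induction ht using Submodule.span_induction with
  | mem t ht =>
    obtain ⟨j, a, i, ha, hj, rfl⟩ := ht
    rw [freeDiff_tmul_single, gradedSign_of_mem A.isInternal ha]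
    refine Submodule.add_mem _ ?_ ?_
    · cases j with
      | zero =>
        rw [A.d_of_mem_zero ha, TensorProduct.zero_tmul]
        exact Submodule.zero_mem _
      | succ j => exact tmul_single_mem_freeGr (A.d_mem ha) (by omega)
    · rcases hi : deg i with _ | l
      · rw [h.eq_zero i hi, smul_zero]
        exact Submodule.zero_mem _
      · obtain rfl : j + l = n := by omega
        exact smul_mem_freeGr (zsmul_mem ha _) (h.mem i l hi)
  | zero => rw [map_zero]; exact Submodule.zero_mem _
  | add s t _ _ hs ht => rw [map_add]; exact Submodule.add_mem _ hs ht
  | smul P t _ ht => rw [map_smul]; exact Submodule.smul_mem _ _ ht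

theorem IsAttaching.freeDiff_of_mem_zero (h : IsAttaching deg δ) {t : FreeCarrier A ι}
    (ht : t ∈ freeGr A deg 0) : freeDiff δ t = 0 := by
  induction ht using Submodule.span_induction with
  | mem t ht =>
    obtain ⟨j, a, i, ha, hj, rfl⟩ := ht
    obtain ⟨rfl, hi⟩ : j = 0 ∧ deg i = 0 := by omega
    rw [freeDiff_tmul_single, A.d_of_mem_zero ha, h.eq_zero i hi, smul_zero,
      TensorProduct.zero_tmul, add_zero]
  | zero => rw [map_zero]
  | add s t _ _ hs ht => rw [map_add, hs, ht, add_zero]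
  | smul P t _ ht => rw [map_smul, ht, smul_zero]

/-- The square is `𝒟`-linear, so it suffices to test `a ⊗ e_i`. There the two terms `± da • δ i`
have opposite signs. -/
theorem IsAttaching.freeDiff_freeDiff (h : IsAttaching deg δ) (t : FreeCarrier A ι) :
    freeDiff δ (freeDiff δ t) = 0 := by
  have : LinearMap.ker (freeDiff δ ∘ₗ freeDiff δ) = ⊤ := by
    apply FreeCarrier.eq_top_of_tmul_single_mem
    intro a i
    induction a using graded_induction A.isInternal with
    | hom j a ha =>
      rw [LinearMap.mem_ker, LinearMap.comp_apply, freeDiff_tmul_single,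
        gradedSign_of_mem A.isInternal ha, map_add, freeDiff_tmul_single, A.d_d,
        TensorProduct.zero_tmul, zero_add, freeDiff_smul δ _ (zsmul_mem ha _), h.cycle, smul_zero,
        add_zero, map_zsmul]
      cases j with
      | zero => rw [A.d_of_mem_zero ha, map_zero, smul_zero, zero_smul, add_zero]
      | succ j =>
        rw [gradedSign_of_mem A.isInternal (A.d_mem ha), ← add_smul, pow_succ, mul_neg_one,
          neg_smul, add_neg_cancel, zero_smul]
    | add a b ha hb => rw [TensorProduct.add_tmul]; exact Submodule.add_mem _ ha hb
  exact LinearMap.mem_ker.1 (this ▸ Submodule.mem_top : t ∈ _)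

theorem zsmul_smul {R M : Type*} [Ring R] [AddCommGroup M] [Module R M] (n : ℤ) (r : R) (m : M) :
    (n • r) • m = n • r • m :=
  smul_assoc n r m

/-- The semi-free `A`-module `(A ⊗_O V, d)` with `d e_i = δ i`. -/
noncomputable def freeDGDMod (h : IsAttaching deg δ) : DGDMod A where
  carrier := FreeCarrier A ι
  gr := freeGr A deg
  isInternal := freeGr_isInternal deg
  smul_mem := smul_mem_freeGr
  der_smul := FreeCarrier.ofDer_smul_smul
  d := freeDiff δ
  d_mem := h.freeDiff_mem
  d_of_mem_zero := h.freeDiff_of_mem_zero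
  d_d := h.freeDiff_freeDiff
  d_smul m ha := (freeDiff_smul δ m ha).trans (congrArg _ (zsmul_smul (M := FreeCarrier A ι) _ _ _))

end FreeDGDMod

/-! ### Maps that preserve degrees -/

section GradedMaps

variable {R M N : Type*} [Ring R] [AddCommGroup M] [Module R M] [AddCommGroup N] [Module R N]
  {gr : ℕ → Submodule R M} {gr' : ℕ → Submodule R N} (h : DirectSum.IsInternal gr)
  (h' : DirectSum.IsInternal gr')

theorem map_gradedProj (φ : M →ₗ[R] N) (hφ : ∀ n, ∀ x ∈ gr n, φ x ∈ gr' n) (n : ℕ) (x : M) :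
    φ (gradedProj h n x) = gradedProj h' n (φ x) := by
  induction x using graded_induction h with
  | hom m x hx =>
    by_cases hmn : m = n
    · subst hmn
      rw [gradedProj_of_mem h hx, gradedProj_of_mem h' (hφ m x hx)]
    · rw [gradedProj_of_mem_ne h hx hmn, gradedProj_of_mem_ne h' (hφ m x hx) hmn, map_zero]
  | add x y hx hy => simp only [map_add, hx, hy]

theorem mem_of_map_mem (h : DirectSum.IsInternal gr) (h' : DirectSum.IsInternal gr')
    (φ : M →ₗ[R] N) (hφ : ∀ n, ∀ x ∈ gr n, φ x ∈ gr' n)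
    (hinj : Function.Injective φ) {n : ℕ} {x : M} (hx : φ x ∈ gr' n) : x ∈ gr n := by
  have : gradedProj h n x = x :=
    hinj (by rw [map_gradedProj h h' φ hφ, gradedProj_of_mem h' hx])
  rw [← this]
  exact gradedProj_mem h n x

end GradedMaps

/-! ### Trivial fibrations -/

namespace DGDMod

section TrivialFibrations

variable {k : Type v} {O : Type u} [Field k] [CommRing O] [Algebra k O] {A : DGDAlg k O}

/-- The projection of an `A`-module to its component of degree `n`. -/
noncomputable abbrev proj (M : DGDMod A) (n : ℕ) : M.carrier →ₗ[DiffOp k O] M.carrier :=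
  gradedProj M.isInternal n

theorem map_proj {M N : DGDMod A} (f : M ⟶ N) (n : ℕ) (x : M.carrier) :
    f.toLin (M.proj n x) = N.proj n (f.toLin x) :=
  map_gradedProj _ _ _ (fun _ _ hx => f.map_mem hx) n x

theorem d_proj_succ (M : DGDMod A) (n : ℕ) (x : M.carrier) :
    M.d (M.proj (n + 1) x) = M.proj n (M.d x) := by
  induction x using graded_induction M.isInternal with
  | hom m x hx =>
    cases m with
    | zero =>
      rw [M.d_of_mem_zero hx, map_zero, gradedProj_of_mem_ne _ hx (Nat.succ_ne_zero n).symm,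
        map_zero]
    | succ m =>
      by_cases hmn : m = n
      · subst hmn
        rw [gradedProj_of_mem _ hx, gradedProj_of_mem _ (M.d_mem hx)]
      · rw [gradedProj_of_mem_ne _ hx (by omega), gradedProj_of_mem_ne _ (M.d_mem hx) hmn, map_zero]
  | add x y hx hy => simp only [map_add, hx, hy]

theorem d_proj_zero (M : DGDMod A) (x : M.carrier) : M.d (M.proj 0 x) = 0 :=
  M.d_of_mem_zero (gradedProj_mem _ 0 x)

theorem d_proj_eq_zero (M : DGDMod A) {x : M.carrier} (hx : M.d x = 0) (n : ℕ) :
    M.d (M.proj n x) = 0 := by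
  cases n with
  | zero => exact M.d_proj_zero x
  | succ n => rw [d_proj_succ, hx, map_zero]

variable {M N : DGDMod A} {f : M ⟶ N}

theorem mapHomology_injective_iff : Function.Injective (mapHomology f) ↔
    ∀ x, M.d x = 0 → f.toLin x ∈ LinearMap.range N.d → x ∈ LinearMap.range M.d := by
  rw [injective_iff_map_eq_zero]
  constructor
  · intro h x hx hfx
    exact (Submodule.Quotient.mk_eq_zero M.boundaries).1
      (h (Submodule.Quotient.mk ⟨x, hx⟩) ((Submodule.Quotient.mk_eq_zero _).2 hfx))
  · intro h x
    obtain ⟨⟨x, hx⟩, rfl⟩ := Submodule.Quotient.mk_surjective _ x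
    intro hfx
    exact (Submodule.Quotient.mk_eq_zero _).2
      (h x hx ((Submodule.Quotient.mk_eq_zero N.boundaries).1 hfx))

theorem mapHomology_surjective_iff : Function.Surjective (mapHomology f) ↔
    ∀ y, N.d y = 0 → ∃ x, M.d x = 0 ∧ f.toLin x - y ∈ LinearMap.range N.d := by
  constructor
  · intro h y hy
    obtain ⟨x, hx⟩ := h (Submodule.Quotient.mk ⟨y, hy⟩)
    obtain ⟨⟨x, hx'⟩, rfl⟩ := Submodule.Quotient.mk_surjective _ x
    exact ⟨x, hx', (Submodule.Quotient.eq N.boundaries).1 hx⟩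
  · intro h y
    obtain ⟨⟨y, hy⟩, rfl⟩ := Submodule.Quotient.mk_surjective _ y
    obtain ⟨x, hx, hxy⟩ := h y hy
    exact ⟨Submodule.Quotient.mk ⟨x, hx⟩, (Submodule.Quotient.eq _).2 hxy⟩

/-- A trivial fibration is surjective on cycles. -/
theorem exists_cycle_of_trivialFibration (hf : trivialFibrations (DGDMod A) f) {n : ℕ}
    {y : N.carrier} (hy : y ∈ N.gr n) (hdy : N.d y = 0) :
    ∃ x ∈ M.gr n, M.d x = 0 ∧ f.toLin x = y := by
  obtain ⟨hfib, hw⟩ := hf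
  obtain ⟨z, hz, w, hw⟩ := mapHomology_surjective_iff.1 hw.2 y hdy
  -- The degree `n + 1` is positive even for `n = 0`, so the fibration condition always lifts this
  -- component of `w`.
  obtain ⟨t, ht, hft⟩ := hfib (n + 1) n.succ_pos (N.proj (n + 1) w) (gradedProj_mem _ _ _)
  refine ⟨M.proj n z - M.d t, Submodule.sub_mem _ (gradedProj_mem _ _ _) (M.d_mem ht), ?_, ?_⟩
  · rw [map_sub, M.d_proj_eq_zero hz, M.d_d, sub_zero]
  · rw [map_sub, f.map_d, hft, d_proj_succ, hw, map_proj, map_sub, gradedProj_of_mem _ hy,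
      sub_sub_cancel]

/-- Trivial fibrations have the lifting property with respect to the inclusions of spheres into
disks. -/
theorem exists_lift_of_trivialFibration (hf : trivialFibrations (DGDMod A) f) {n : ℕ}
    {y : N.carrier} (hy : y ∈ N.gr n) {w : M.carrier} (hw0 : n = 0 → w = 0)
    (hwn : ∀ m, n = m + 1 → w ∈ M.gr m) (hdw : M.d w = 0) (hfw : f.toLin w = N.d y) :
    ∃ x ∈ M.gr n, f.toLin x = y ∧ M.d x = w := by
  -- The fibration condition says nothing in degree zero, but there every element is a cycle.
  obtain ⟨x, hx, hfx⟩ : ∃ x ∈ M.gr n, f.toLin x = y := by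
    rcases Nat.eq_zero_or_pos n with rfl | hn
    · obtain ⟨x, hx, _, hfx⟩ := exists_cycle_of_trivialFibration hf hy (N.d_of_mem_zero hy)
      exact ⟨x, hx, hfx⟩
    · exact hf.1 n hn y hy
  have hf0 : f.toLin (w - M.d x) = 0 := by rw [map_sub, f.map_d, hfx, hfw, sub_self]
  obtain ⟨t, ht⟩ := mapHomology_injective_iff.1 hf.2.1 (w - M.d x)
    (by rw [map_sub, hdw, M.d_d, sub_zero]) (by rw [hf0]; exact Submodule.zero_mem _)
  have ht' : M.d (M.proj n t) = w - M.d x := by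
    cases n with
    | zero => rw [d_proj_zero, hw0 rfl, M.d_of_mem_zero hx, sub_zero]
    | succ n =>
      rw [d_proj_succ, ht, gradedProj_of_mem _ (Submodule.sub_mem _ (hwn n rfl) (M.d_mem hx))]
  -- The correction `t` repairs the boundary of `x` but changes its image by a cycle. Subtracting a
  -- cycle `z` over that image restores the image and keeps the boundary.
  obtain ⟨z, hz, hdz, hfz⟩ := exists_cycle_of_trivialFibration hf
    (f.map_mem (gradedProj_mem M.isInternal n t)) (by rw [← f.map_d, ht', hf0])
  refine ⟨x + (M.proj n t - z),
    Submodule.add_mem _ hx (Submodule.sub_mem _ (gradedProj_mem _ _ _) hz), ?_, ?_⟩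
  · rw [map_add, map_sub, hfz, hfx, sub_self, add_zero]
  · rw [map_add, map_sub, ht', hdz, sub_zero, add_sub_cancel]

theorem mapHomology_bijective_of_homogeneous
    (hsurj : ∀ n, ∀ y ∈ N.gr n, N.d y = 0 → ∃ x, M.d x = 0 ∧ f.toLin x = y)
    (hinj : ∀ n, ∀ x ∈ M.gr n, M.d x = 0 → ∀ y ∈ N.gr (n + 1), f.toLin x = N.d y →
      x ∈ LinearMap.range M.d) : Function.Bijective (mapHomology f) := by
  constructor
  · rw [mapHomology_injective_iff]
    rintro x hx ⟨y, hy⟩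
    refine mem_of_gradedProj_mem M.isInternal fun n => ?_
    refine hinj n _ (gradedProj_mem _ _ _) (M.d_proj_eq_zero hx n) (N.proj (n + 1) y)
      (gradedProj_mem _ _ _) ?_
    rw [d_proj_succ, hy, map_proj]
  · rw [mapHomology_surjective_iff]
    intro y hy
    have : y ∈ (LinearMap.ker M.d).map f.toLin := by
      refine mem_of_gradedProj_mem N.isInternal fun n => ?_
      exact hsurj n _ (gradedProj_mem _ _ _) (N.d_proj_eq_zero hy n)
    obtain ⟨x, hx, hxy⟩ := this
    exact ⟨x, hx, by rw [hxy, sub_self]; exact Submodule.zero_mem _⟩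

/-- Maps out of the initial object are unique, so only the lower triangle of a lifting square
carries a condition. -/
theorem isCofibrant_iff_exists_lift (C : DGDMod A) : IsCofibrant C ↔
    ∀ {X Y : DGDMod A} (p : X ⟶ Y), trivialFibrations (DGDMod A) p →
      ∀ g : C ⟶ Y, ∃ l : C ⟶ X, l ≫ p = g := by
  rw [isCofibrant_iff, cofibration_iff]
  constructor
  · intro h X Y p hp g
    have := h p hp
    have sq : CommSq (initial.to X) (initial.to C) p g := ⟨initial.hom_ext _ _⟩
    exact ⟨sq.lift, sq.fac_right⟩
  · intro h X Y p hp
    refine ⟨fun {f g} sq => ?_⟩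
    obtain ⟨l, hl⟩ := h p hp g
    exact ⟨⟨⟨l, initial.hom_ext _ _, hl⟩⟩⟩

end TrivialFibrations

/-! ### Sullivan modules are cofibrant -/

section Sullivan

variable {k : Type v} {O : Type u} [Field k] [CommRing O] [Algebra k O] [CharZero k]
  [Algebra.Smooth k O] {A : DGDAlg k O} {ι : Type u}

theorem _root_.FreeCarrier.hom_ext {M : Type*} [AddCommGroup M] [Module (DiffOp k O) M]
    {φ ψ : FreeCarrier A ι →ₗ[DiffOp k O] M}
    (h : ∀ (j : ℕ) (i : ι), ∀ a ∈ A.gr j,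
      φ (a ⊗ₜ Finsupp.single i 1) = ψ (a ⊗ₜ Finsupp.single i 1)) : φ = ψ := by
  rw [← LinearMap.eqLocus_eq_top]
  apply FreeCarrier.eq_top_of_tmul_single_mem
  intro a i
  induction a using graded_induction A.isInternal with
  | hom j a ha => exact h j i a ha
  | add a b ha hb => rw [TensorProduct.add_tmul]; exact Submodule.add_mem _ ha hb

theorem freeMap_eq_freeLift (S : DGDMod A) (m : ι → S.carrier) (t : FreeCarrier A ι) :
    S.freeMap m t = freeLift S.der_smul m t := rfl

theorem freeLift_mem (S : DGDMod A) {deg : ι → ℕ} {m : ι → S.carrier}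
    (hm : ∀ i, m i ∈ S.gr (deg i)) {n : ℕ} {t : FreeCarrier A ι} (ht : t ∈ freeGr A deg n) :
    freeLift S.der_smul m t ∈ S.gr n := by
  induction ht using Submodule.span_induction with
  | mem t ht =>
    obtain ⟨j, a, i, ha, rfl, rfl⟩ := ht
    rw [freeLift_tmul_single]
    exact S.smul_mem ha (hm i)
  | zero => rw [map_zero]; exact Submodule.zero_mem _
  | add s t _ _ hs ht => rw [map_add]; exact Submodule.add_mem _ hs ht
  | smul P t _ ht => rw [map_smul]; exact Submodule.smul_mem _ _ ht

theorem IsSullivan.exists_lift {S X Y : DGDMod A} (hS : S.IsSullivan) {p : X ⟶ Y}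
    (hp : trivialFibrations (DGDMod A) p) (g : S ⟶ Y) : ∃ l : S ⟶ X, l ≫ p = g := by
  classical
  obtain ⟨ι, _, _, deg, m, hm, hbij, hd⟩ := hS
  choose w hw using hd
  let e : FreeCarrier A ι ≃ₗ[DiffOp k O] S.carrier :=
    LinearEquiv.ofBijective (freeLift S.der_smul m) hbij
  -- The recursion falls back on `0` when no suitable `y` exists; `key` shows that this never
  -- happens.
  let step : ∀ α : ι, (∀ β, β < α → X.carrier) → X.carrier := fun α rec =>
    if h : ∃ y ∈ X.gr (deg α), p.toLin y = g.toLin (m α) ∧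
      X.d y = X.freeMap (fun β : {β : ι // β < α} => rec β β.2) (w α) then h.choose else 0
  let x : ι → X.carrier := (wellFounded_lt (α := ι)).fix step
  have hx : ∀ α, x α = step α fun β _ => x β := (wellFounded_lt (α := ι)).fix_eq step
  have hxdeg : ∀ α, x α ∈ X.gr (deg α) := by
    intro α
    rw [hx]
    dsimp only [step]
    split_ifs with h
    · exact h.choose_spec.1
    · exact Submodule.zero_mem _
  -- Any choice of images `x` extends linearly, so `Φ` is available before its compatibility with
  -- `d` and `p` is known.
  let Φ : S.carrier →ₗ[DiffOp k O] X.carrier := freeLift X.der_smul x ∘ₗ e.symm.toLinearMap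
  have hΦe : ∀ t, Φ (e t) = freeLift X.der_smul x t := fun t =>
    congrArg (freeLift X.der_smul x) (e.symm_apply_apply t)
  have hesmul : ∀ (a : A.carrier) t, e (a • t) = a • e t := freeLift_smul S.der_smul m
  have heS : ∀ (a : A.carrier) α, e (a ⊗ₜ Finsupp.single α 1) = a • m α :=
    freeLift_tmul_single S.der_smul m
  have hΦsmul : ∀ (a : A.carrier) s, Φ (a • s) = a • Φ s := by
    intro a s
    obtain ⟨t, rfl⟩ := e.surjective s
    rw [← hesmul, hΦe, hΦe, freeLift_smul]
  have hΦm : ∀ α, Φ (m α) = x α := by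
    intro α
    rw [← one_smul A.carrier (m α), ← heS, hΦe, freeLift_tmul_single, one_smul]
  have hΦmem : ∀ {n} {s : S.carrier}, s ∈ S.gr n → Φ s ∈ X.gr n := by
    intro n s hs
    obtain ⟨t, rfl⟩ := e.surjective s
    rw [hΦe]
    exact freeLift_mem X hxdeg (mem_of_map_mem (freeGr_isInternal deg) S.isInternal e.toLinearMap
      (fun n t ht => freeLift_mem S hm ht) e.injective hs)
  -- The subfamily `φ` is used twice: for the generators below `α` during the induction, and for all
  -- of them at the end.
  have hΦd : ∀ {κ : Type u} (φ : κ → ι), (∀ b, X.d (x (φ b)) = Φ (S.d (m (φ b)))) →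
      ∀ t, X.d (Φ (freeLift S.der_smul (fun b => m (φ b)) t))
        = Φ (S.d (freeLift S.der_smul (fun b => m (φ b)) t)) := by
    intro κ φ hφ t
    refine LinearMap.congr_fun (FreeCarrier.hom_ext (φ := X.d ∘ₗ Φ ∘ₗ freeLift S.der_smul _)
      (ψ := Φ ∘ₗ S.d ∘ₗ freeLift S.der_smul _) ?_) t
    intro j b a ha
    simp only [LinearMap.comp_apply, freeLift_tmul_single, hΦsmul, hΦm, X.d_smul _ ha, hφ,
      S.d_smul _ ha, map_add, map_zsmul]
  have hΦp : ∀ {κ : Type u} (φ : κ → ι), (∀ b, p.toLin (x (φ b)) = g.toLin (m (φ b))) →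
      ∀ t, p.toLin (Φ (freeLift S.der_smul (fun b => m (φ b)) t))
        = g.toLin (freeLift S.der_smul (fun b => m (φ b)) t) := by
    intro κ φ hφ t
    refine LinearMap.congr_fun (FreeCarrier.hom_ext
      (φ := p.toLin ∘ₗ Φ ∘ₗ freeLift S.der_smul _) (ψ := g.toLin ∘ₗ freeLift S.der_smul _) ?_) t
    intro j b a ha
    simp only [LinearMap.comp_apply, freeLift_tmul_single, hΦsmul, hΦm, p.map_smul, hφ,
      g.map_smul]
  have hΦlt : ∀ α, X.freeMap (fun β : {β : ι // β < α} => x β) (w α) = Φ (S.d (m α)) := by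
    intro α
    rw [← hw α]
    refine LinearMap.congr_fun (FreeCarrier.hom_ext (φ := freeLift X.der_smul _)
      (ψ := Φ ∘ₗ freeLift S.der_smul _) ?_) (w α)
    intro j b a ha
    simp only [LinearMap.comp_apply, freeLift_tmul_single, hΦsmul, hΦm]
  have key : ∀ α, p.toLin (x α) = g.toLin (m α) ∧ X.d (x α) = Φ (S.d (m α)) := by
    intro α
    induction α using WellFoundedLT.induction with
    | ind α ih =>
      have hex : ∃ y ∈ X.gr (deg α), p.toLin y = g.toLin (m α) ∧
          X.d y = X.freeMap (fun β : {β : ι // β < α} => x β) (w α) := by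
        rw [hΦlt]
        refine exists_lift_of_trivialFibration hp (g.map_mem (hm α)) ?_ ?_ ?_ ?_
        · intro h0
          rw [S.d_of_mem_zero (h0 ▸ hm α), map_zero]
        · intro n hn
          exact hΦmem (S.d_mem (hn ▸ hm α))
        · rw [← hw α, freeMap_eq_freeLift, hΦd Subtype.val fun b => (ih b b.2).2, ← freeMap_eq_freeLift,
            hw α, S.d_d, map_zero]
        · rw [← hw α, freeMap_eq_freeLift, hΦp Subtype.val fun b => (ih b b.2).1, ← freeMap_eq_freeLift,
            hw α, g.map_d]
      have hxα : x α = hex.choose := by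
        rw [hx]
        exact dif_pos hex
      rw [hxα, ← hΦlt]
      exact hex.choose_spec.2
  refine ⟨{ toLin := Φ, map_smul := hΦsmul, map_mem := hΦmem, map_d := fun s => ?_ }, ?_⟩
  · obtain ⟨t, rfl⟩ := e.surjective s
    exact (hΦd id (fun α => (key α).2) t).symm
  · apply Hom.ext
    ext s
    obtain ⟨t, rfl⟩ := e.surjective s
    exact hΦp id (fun α => (key α).1) t

theorem isCofibrant_of_retract {C S : DGDMod A} (hS : S.IsSullivan) (r : Retract C S) :
    IsCofibrant C := by
  rw [isCofibrant_iff_exists_lift]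
  intro X Y p hp g
  obtain ⟨l, hl⟩ := hS.exists_lift hp (r.r ≫ g)
  exact ⟨r.i ≫ l, by rw [Category.assoc, hl, r.retract_assoc]⟩

end Sullivan

end DGDMod

/-! ### Sullivan resolutions -/

section Resolution

variable {k : Type v} {O : Type u} [Field k] [CommRing O] [Algebra k O] {A : DGDAlg k O}

/-- Formal cells over `C`: a cell consists of a degree, a formal boundary `∑ P_i (a_i ⊗ g_i)`, where
the `g_i` are cells, and an element of `C`. -/
inductive Cell (C : DGDMod A) : Type u
  | mk (deg n : ℕ) (P : Fin n → DiffOp k O) (a : Fin n → A.carrier) (g : Fin n → Cell C)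
      (c : C.carrier) : Cell C

namespace Cell

variable {C : DGDMod A}

/-- The degree of a cell. -/
def deg : Cell C → ℕ
  | mk N _ _ _ _ _ => N

/-- `IsFace g g'`: the cell `g` occurs in the formal boundary of `g'`. -/
inductive IsFace : Cell C → Cell C → Prop
  | mk (N n : ℕ) (P : Fin n → DiffOp k O) (a : Fin n → A.carrier) (g : Fin n → Cell C)
      (c : C.carrier) (i : Fin n) : IsFace (g i) (Cell.mk N n P a g c)

instance : IsWellFounded (Cell C) IsFace where
  wf := by
    constructor
    intro g
    induction g with
    | mk N n P a g c ih =>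
      constructor
      rintro _ ⟨⟩
      exact ih _

variable [CharZero k] [Algebra.Smooth k O]

/-- The element `∑ P_i (a_i ⊗ g_i)`. -/
noncomputable def formalBoundary {n : ℕ} (P : Fin n → DiffOp k O) (a : Fin n → A.carrier)
    (g : Fin n → Cell C) : FreeCarrier A (Cell C) :=
  ∑ i, P i • (a i ⊗ₜ Finsupp.single (g i) 1 : FreeCarrier A (Cell C))

/-- The condition for a formal cell to be attached along its formal boundary, in terms of the
boundaries `δ` and the images `v` in `C` of the cells that occur in it. -/
structure IsAdmissible (N : ℕ) {n : ℕ} (P : Fin n → DiffOp k O) (a : Fin n → A.carrier)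
    (g : Fin n → Cell C) (c : C.carrier) (δ : Fin n → FreeCarrier A (Cell C))
    (v : Fin n → C.carrier) : Prop where
  mem : c ∈ C.gr N
  eq_zero : N = 0 → formalBoundary P a g = 0
  boundary_mem : ∀ m, N = m + 1 → formalBoundary P a g ∈ freeGr A deg m
  -- The next two conditions spell out the differential and the augmentation of the formal boundary
  -- through their values on its faces, the only values known during the recursion.
  cycle : ∑ i, P i • ((A.d (a i) ⊗ₜ Finsupp.single (g i) 1 : FreeCarrier A (Cell C))
    + gradedSign A.isInternal (a i) • δ i) = 0
  d_eq : ∑ i, P i • a i • v i = C.d c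

open Classical in
/-- The boundary of a cell and its image in `C`. Cells that are not admissible have boundary `0` and
image `0`. -/
noncomputable def attach : Cell C → FreeCarrier A (Cell C) × C.carrier
  | mk N _ P a g c =>
    if IsAdmissible N P a g c (fun i => (attach (g i)).1) (fun i => (attach (g i)).2) then
      (formalBoundary P a g, c) else 0

/-- The boundary of a cell. -/
noncomputable def boundary (g : Cell C) : FreeCarrier A (Cell C) := g.attach.1

/-- The image of a cell in `C`. -/
noncomputable def image (g : Cell C) : C.carrier := g.attach.2

theorem freeDiff_formalBoundary {n : ℕ} (P : Fin n → DiffOp k O) (a : Fin n → A.carrier)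
    (g : Fin n → Cell C) : freeDiff boundary (formalBoundary P a g)
      = ∑ i, P i • ((A.d (a i) ⊗ₜ Finsupp.single (g i) 1 : FreeCarrier A (Cell C))
        + gradedSign A.isInternal (a i) • (g i).boundary) := by
  rw [formalBoundary, map_sum]
  exact Finset.sum_congr rfl fun i _ => by rw [map_smul, freeDiff_tmul_single]

theorem freeLift_formalBoundary {n : ℕ} (P : Fin n → DiffOp k O) (a : Fin n → A.carrier)
    (g : Fin n → Cell C) : freeLift C.der_smul image (formalBoundary P a g)
      = ∑ i, P i • a i • (g i).image := by
  rw [formalBoundary, map_sum]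
  exact Finset.sum_congr rfl fun i _ => by rw [map_smul, freeLift_tmul_single]

/-- Inadmissible cells survive as free generators with zero boundary mapping to zero, which does no
harm. -/
theorem attach_cases (g : Cell C) :
    (∃ (N n : ℕ) (P : Fin n → DiffOp k O) (a : Fin n → A.carrier) (g' : Fin n → Cell C)
      (c : C.carrier), g = mk N n P a g' c ∧
        IsAdmissible N P a g' c (fun i => (g' i).boundary) (fun i => (g' i).image) ∧
        g.boundary = formalBoundary P a g' ∧ g.image = c) ∨ (g.boundary = 0 ∧ g.image = 0) := by
  classical
  obtain ⟨N, n, P, a, g, c⟩ := g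
  by_cases h : IsAdmissible N P a g c (fun i => (g i).boundary) (fun i => (g i).image)
  · left
    have : (mk N n P a g c).attach = (formalBoundary P a g, c) := by
      rw [attach]
      exact if_pos h
    exact ⟨N, n, P, a, g, c, rfl, h, congrArg Prod.fst this, congrArg Prod.snd this⟩
  · right
    have : (mk N n P a g c).attach = 0 := by
      rw [attach]
      exact if_neg h
    exact ⟨congrArg Prod.fst this, congrArg Prod.snd this⟩

theorem isAttaching_boundary : IsAttaching deg (boundary (C := C)) where
  eq_zero g hg := by
    obtain ⟨N, n, P, a, g, c, rfl, h, hb, -⟩ | ⟨hb, -⟩ := g.attach_cases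
    · rw [hb, h.eq_zero hg]
    · exact hb
  mem g n hg := by
    obtain ⟨N, n, P, a, g, c, rfl, h, hb, -⟩ | ⟨hb, -⟩ := g.attach_cases
    · rw [hb]
      exact h.boundary_mem _ hg
    · rw [hb]
      exact Submodule.zero_mem _
  cycle g := by
    obtain ⟨N, n, P, a, g, c, rfl, h, hb, -⟩ | ⟨hb, -⟩ := g.attach_cases
    · rw [hb, freeDiff_formalBoundary, h.cycle]
    · rw [hb, map_zero]

theorem image_mem (g : Cell C) : g.image ∈ C.gr g.deg := by
  obtain ⟨N, n, P, a, g, c, rfl, h, -, hc⟩ | ⟨-, hc⟩ := g.attach_cases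
  · rw [hc]
    exact h.mem
  · rw [hc]
    exact Submodule.zero_mem _

theorem freeLift_boundary (g : Cell C) : freeLift C.der_smul image g.boundary = C.d g.image := by
  obtain ⟨N, n, P, a, g, c, rfl, h, hb, hc⟩ | ⟨hb, hc⟩ := g.attach_cases
  · rw [hb, hc, freeLift_formalBoundary, h.d_eq]
  · rw [hb, hc, map_zero, map_zero]

/-- The tensors `a ⊗ e_g` span over `𝒟`, so the finite data stored in a cell reach every element. -/
theorem exists_formalBoundary_eq (t : FreeCarrier A (Cell C)) :
    ∃ (n : ℕ) (P : Fin n → DiffOp k O) (a : Fin n → A.carrier) (g : Fin n → Cell C),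
      formalBoundary P a g = t := by
  have ht : t ∈ Submodule.span (DiffOp k O) (Set.range fun x : A.carrier × Cell C =>
      (x.1 ⊗ₜ Finsupp.single x.2 1 : FreeCarrier A (Cell C))) := by
    have h := FreeCarrier.eq_top_of_tmul_single_mem (Submodule.span (DiffOp k O) (Set.range
      fun x : A.carrier × Cell C => (x.1 ⊗ₜ Finsupp.single x.2 1 : FreeCarrier A (Cell C))))
      fun a i => Submodule.subset_span ⟨(a, i), rfl⟩
    rw [h]
    trivial
  obtain ⟨n, P, s, hs⟩ := Submodule.mem_span_set'.1 ht
  choose y hy using fun i => (s i).2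
  refine ⟨n, P, fun i => (y i).1, fun i => (y i).2, ?_⟩
  rw [← hs]
  exact Finset.sum_congr rfl fun i _ => congrArg (P i • ·) (hy i)

/-- Every cycle `t` whose image in `C` is the boundary of `c` is the boundary of a cell over `c`. -/
theorem exists_cell {N : ℕ} {t : FreeCarrier A (Cell C)} {c : C.carrier} (hc : c ∈ C.gr N)
    (h0 : N = 0 → t = 0) (hN : ∀ m, N = m + 1 → t ∈ freeGr A deg m)
    (hcycle : freeDiff boundary t = 0) (hd : freeLift C.der_smul image t = C.d c) :
    ∃ g : Cell C, g.deg = N ∧ g.boundary = t ∧ g.image = c := by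
  obtain ⟨n, P, a, g, rfl⟩ := exists_formalBoundary_eq t
  have h : IsAdmissible N P a g c (fun i => (g i).boundary) (fun i => (g i).image) :=
    ⟨hc, h0, hN, by rw [← freeDiff_formalBoundary, hcycle],
      by rw [← freeLift_formalBoundary, hd]⟩
  have : (mk N n P a g c).attach = (formalBoundary P a g, c) := by
    rw [attach]
    exact if_pos h
  exact ⟨mk N n P a g c, rfl, congrArg Prod.fst this, congrArg Prod.snd this⟩

theorem exists_cell_of_cycle {N : ℕ} {c : C.carrier} (hc : c ∈ C.gr N) (hd : C.d c = 0) :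
    ∃ g : Cell C, g.deg = N ∧ g.boundary = 0 ∧ g.image = c :=
  exists_cell hc (fun _ => rfl) (fun _ _ => Submodule.zero_mem _) (map_zero _)
    (by rw [map_zero, hd])

end Cell

namespace DGDMod

variable [CharZero k] [Algebra.Smooth k O] (C : DGDMod A)

/-- The semi-free `A`-module on the cells over `C`. -/
noncomputable def sullivanResolution : DGDMod A := freeDGDMod (Cell.isAttaching_boundary (C := C))

/-- The generator of the resolution given by a cell. -/
noncomputable def cellGenerator (g : Cell C) : C.sullivanResolution.carrier :=
  ((1 : A.carrier) ⊗ₜ Finsupp.single g 1 : FreeCarrier A (Cell C))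

theorem cellGenerator_mem (g : Cell C) :
    C.cellGenerator g ∈ C.sullivanResolution.gr g.deg :=
  tmul_single_mem_freeGr A.one_mem (zero_add _)

theorem d_cellGenerator (g : Cell C) :
    C.sullivanResolution.d (C.cellGenerator g) = g.boundary := by
  change freeDiff Cell.boundary _ = _
  rw [cellGenerator, freeDiff_tmul_single, A.d_of_mem_zero A.one_mem, TensorProduct.zero_tmul,
    zero_add, gradedSign_of_mem A.isInternal A.one_mem, pow_zero, one_smul, one_smul]

/-- The augmentation of the resolution. -/
noncomputable def augmentation : C.sullivanResolution ⟶ C where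
  toLin := freeLift C.der_smul Cell.image
  map_smul := freeLift_smul C.der_smul _
  map_mem := freeLift_mem C Cell.image_mem
  map_d t := by
    refine LinearMap.congr_fun (FreeCarrier.hom_ext
      (φ := freeLift C.der_smul Cell.image ∘ₗ freeDiff Cell.boundary)
      (ψ := C.d ∘ₗ freeLift C.der_smul Cell.image) ?_) t
    intro j g a ha
    rw [LinearMap.comp_apply, LinearMap.comp_apply, freeDiff_tmul_single, map_add, freeLift_smul,
      freeLift_tmul_single, freeLift_tmul_single, Cell.freeLift_boundary,
      gradedSign_of_mem A.isInternal ha, zsmul_smul, C.d_smul _ ha]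

theorem augmentation_cellGenerator (g : Cell C) :
    C.augmentation.toLin (C.cellGenerator g) = g.image :=
  (freeLift_tmul_single C.der_smul Cell.image 1 g).trans (one_smul _ _)

theorem trivialFibrations_augmentation : trivialFibrations (DGDMod A) C.augmentation := by
  have hsurj : ∀ n, ∀ y ∈ C.gr n, C.d y = 0 → ∃ g : Cell C, g.deg = n ∧
      C.sullivanResolution.d (C.cellGenerator g) = 0 ∧
      C.augmentation.toLin (C.cellGenerator g) = y := by
    intro n y hy hdy
    obtain ⟨g, hg, hb, hi⟩ := Cell.exists_cell_of_cycle hy hdy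
    exact ⟨g, hg, by rw [d_cellGenerator, hb]; rfl, by rw [augmentation_cellGenerator, hi]⟩
  have hinj : ∀ n, ∀ x ∈ C.sullivanResolution.gr n, C.sullivanResolution.d x = 0 →
      ∀ y ∈ C.gr (n + 1), C.augmentation.toLin x = C.d y → ∃ g : Cell C, g.deg = n + 1 ∧
        C.sullivanResolution.d (C.cellGenerator g) = x ∧
        C.augmentation.toLin (C.cellGenerator g) = y := by
    intro n x hx hdx y hy hxy
    obtain ⟨g, hg, hb, hi⟩ := Cell.exists_cell (t := x) hy (fun h => absurd h n.succ_ne_zero)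
      (fun m hm => by obtain rfl : n = m := by omega
                      exact hx) hdx hxy
    exact ⟨g, hg, by rw [d_cellGenerator, hb], by rw [augmentation_cellGenerator, hi]⟩
  constructor
  · intro n hn y hy
    -- A cell over the cycle `d y` serves as the boundary of a second cell over `y`.
    obtain ⟨m, rfl⟩ := Nat.exists_eq_add_one.2 hn
    obtain ⟨g, rfl, hg, hgy⟩ := hsurj m (C.d y) (C.d_mem hy) (C.d_d y)
    obtain ⟨g', hg', -, hgy'⟩ := hinj _ _ (C.cellGenerator_mem g) hg y hy hgy
    exact ⟨C.cellGenerator g', hg' ▸ C.cellGenerator_mem g', hgy'⟩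
  · refine mapHomology_bijective_of_homogeneous ?_ ?_
    · intro n y hy hdy
      obtain ⟨g, -, hg, hgy⟩ := hsurj n y hy hdy
      exact ⟨_, hg, hgy⟩
    · intro n x hx hdx y hy hxy
      obtain ⟨g, -, hg, -⟩ := hinj n x hx hdx y hy hxy
      exact ⟨_, hg⟩

theorem isSullivan_sullivanResolution : C.sullivanResolution.IsSullivan := by
  have hid : freeLift C.sullivanResolution.der_smul C.cellGenerator
      = (LinearMap.id : FreeCarrier A (Cell C) →ₗ[DiffOp k O] FreeCarrier A (Cell C)) := by
    refine FreeCarrier.hom_ext fun j g a _ => ?_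
    rw [freeLift_tmul_single]
    change a • ((1 : A.carrier) ⊗ₜ Finsupp.single g 1 : FreeCarrier A (Cell C)) = _
    rw [TensorProduct.smul_tmul', smul_eq_mul, mul_one]
    rfl
  -- This well-order compares ranks under `IsFace` first, so every face precedes its cell.
  let _ := IsWellFounded.wellOrderExtension (Cell.IsFace (C := C))
  refine ⟨Cell C, inferInstance, IsWellFounded.wellOrderExtension.isWellFounded_lt _, Cell.deg,
    C.cellGenerator, C.cellGenerator_mem, ?_, fun g => ?_⟩
  · change Function.Bijective (freeLift C.sullivanResolution.der_smul C.cellGenerator)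
    rw [hid]
    exact Function.bijective_id
  · rw [d_cellGenerator]
    suffices g.boundary ∈ LinearMap.range (freeLift C.sullivanResolution.der_smul
        fun g' : {g' : Cell C // g' < g} => C.cellGenerator g') from this
    obtain ⟨N, n, P, a, g, c, rfl, -, hb, -⟩ | ⟨hb, -⟩ := g.attach_cases
    · rw [hb]
      refine Submodule.sum_mem _ fun i _ => Submodule.smul_mem _ _ ?_
      have hi : g i < Cell.mk N n P a g c :=
        Prod.Lex.left _ _ (IsWellFounded.rank_lt_of_rel (Cell.IsFace.mk N n P a g c i))
      refine ⟨a i ⊗ₜ Finsupp.single ⟨g i, hi⟩ 1, ?_⟩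
      rw [freeLift_tmul_single]
      change a i • ((1 : A.carrier) ⊗ₜ Finsupp.single (g i) 1 : FreeCarrier A (Cell C)) = _
      rw [TensorProduct.smul_tmul', smul_eq_mul, mul_one]
    · rw [hb]
      exact Submodule.zero_mem _

end DGDMod

end Resolution

theorem theoremL {k : Type v} [Field k] [IsAlgClosed k] [CharZero k]
    {O : Type u} [CommRing O] [Algebra k O] [Algebra.Smooth k O]
    (A : DGDAlg k O) (C : DGDMod A) :
    IsCofibrant C ↔ ∃ S : DGDMod A, S.IsSullivan ∧ Nonempty (Retract C S) := by
  constructor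
  · intro hC
    obtain ⟨l, hl⟩ := (DGDMod.isCofibrant_iff_exists_lift C).1 hC C.augmentation
      C.trivialFibrations_augmentation (𝟙 C)
    exact ⟨C.sullivanResolution, C.isSullivan_sullivanResolution, ⟨⟨l, C.augmentation, hl⟩⟩⟩
  · rintro ⟨S, hS, ⟨r⟩⟩
    exact DGDMod.isCofibrant_of_retract hS r
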